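/- Let $1\le k\le n$ be integers and let $f$ be a smooth, positive, even function on the round unit sphere $S^n\subset\mathbb R^{n+1}$ (even means $f(-x)=f(x)$). For a smooth positive function $\varphi$ on $S^n$ put $$U=A[\varphi]=D^2\varphi-\frac{|D\varphi|^2}{2\varphi}\,I+\frac12\Big(\varphi-\frac1\varphi\Big)I ,$$ where $D$ is the Levi-Civita connection of the round metric and $A[\varphi](x)$ is regarded as a self-adjoint endomorphism of $T_xS^n$. Call $\varphi$ admissible if it is smooth, positive and even, if $A[\varphi]$ is positive definite at every point (uniform h-convexity), and if $$\frac{\sigma_n(A[\varphi])}{\sigma_{n-k}(A[\varphi])}=\varphi^{-k}f\quad\text{on }S^n,$$ where $\sigma_j$ is the $j$-th elementary symmetric function of the eigenvalues and $\sigma_0=1$. Then: (i) For all $C_0,C_1>0$ there is a constant $C>0$, depending only on $n,k,f,C_0,C_1$, such that every admissible $\varphi$ with $\frac1{C_0}\le\log\varphi\le C_0$ and $|D\varphi|\le C_1$ on $S^n$ satisfies $\lambda\le C$ for every eigenvalue $\lambda$ of $U(x)$ and every $x\in S^n$. (ii) There is a constant $C>0$, depending only on $n,k,f$, such that for every admissible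 $\varphi$ one has $\lambda\le C$ for every eigenvalue $\lambda$ of $U(x)$ and every $x\in S^n$. -/

import Mathlib

open scoped Manifold ContDiff

noncomputable section

namespace HessianQuotient

/-- The unit sphere `S^n` in `ℝ^(n+1)`. -/
abbrev Sph (n : ℕ) : Type := Metric.sphere (0 : EuclideanSpace ℝ (Fin (n + 1))) 1

/-- The tangent space `T_x S^n`, realised as the hyperplane `x^⊥` of `ℝ^(n+1)`, with the induced
inner product (the round metric). -/
abbrev Tan {n : ℕ} (x : Sph n) : Submodule ℝ (EuclideanSpace ℝ (Fin (n + 1))) :=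
  (Submodule.span ℝ {(x : EuclideanSpace ℝ (Fin (n + 1)))})ᗮ

/-- The extension of a function on `S^n` to `ℝ^(n+1)` which is constant on open rays from the
origin: `y ↦ φ (y / |y|)` (with the value `0` at the origin, which plays no role). -/
def radialExt {n : ℕ} (φ : Sph n → ℝ) (y : EuclideanSpace ℝ (Fin (n + 1))) : ℝ :=
  if h : y = 0 then 0 else φ ⟨‖y‖⁻¹ • y, by simp [norm_smul, h]⟩

/-- The gradient `Dφ` on `S^n` with respect to the round metric, as a vector of `ℝ^(n+1)`.
Since the extension is constant along rays, its Euclidean gradient at a point `x` of the sphere is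
tangent to the sphere, and it is the Riemannian gradient of `φ`. -/
def grad {n : ℕ} (φ : Sph n → ℝ) (x : Sph n) : EuclideanSpace ℝ (Fin (n + 1)) :=
  gradient (radialExt φ) (x : EuclideanSpace ℝ (Fin (n + 1)))

/-- The Hessian `D²φ` on `S^n` for the Levi-Civita connection `D` of the round metric, as an
endomorphism of `T_x S^n`: `v ↦ D_v (Dφ)`. The Levi-Civita connection of the sphere is the
tangential part of the Euclidean derivative; the vector field differentiated here is the Euclidean
gradient of the extension, which coincides with `Dφ` along the sphere. -/
def hess {n : ℕ} (φ : Sph n → ℝ) (x : Sph n) : Tan x →ₗ[ℝ] Tan x :=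
  ((Tan x).orthogonalProjectionOnto.comp
    ((fderiv ℝ (gradient (radialExt φ)) (x : EuclideanSpace ℝ (Fin (n + 1)))).comp
      (Tan x).subtypeL)).toLinearMap

/-- `A[φ] = D²φ - |Dφ|²/(2φ) I + (1/2)(φ - 1/φ) I`, as an endomorphism of `T_x S^n`. -/
def A {n : ℕ} (φ : Sph n → ℝ) (x : Sph n) : Tan x →ₗ[ℝ] Tan x :=
  hess φ x - (‖grad φ x‖ ^ 2 / (2 * φ x)) • LinearMap.id
    + ((φ x - 1 / φ x) / 2) • LinearMap.id

/-- `σ_j(T)`: the `j`-th elementary symmetric function of the eigenvalues of `T`, listed with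
multiplicity as the roots of the characteristic polynomial (for a self-adjoint `T` all of them are
real, so that there are `dim V` of them). -/
def sigma {V : Type*} [AddCommGroup V] [Module ℝ V] [Module.Finite ℝ V] [Module.Free ℝ V]
    (j : ℕ) (T : V →ₗ[ℝ] V) : ℝ :=
  T.charpoly.roots.esymm j

/-- `φ` is a smooth, positive, even, uniformly h-convex (that is, `A[φ] > 0` everywhere) solution
of `σ_n(A[φ]) / σ_{n-k}(A[φ]) = φ^{-k} f` on `S^n`. -/
structure IsSolution (n k : ℕ) (f φ : Sph n → ℝ) : Prop where
  smooth : ContMDiff (𝓡 n) 𝓘(ℝ, ℝ) ∞ φ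
  pos : ∀ x, 0 < φ x
  even : ∀ x, φ (-x) = φ x
  hconvex : ∀ x, ∀ v : Tan x, v ≠ 0 → 0 < inner ℝ (A φ x v) v
  eqn : ∀ x, sigma n (A φ x) / sigma (n - k) (A φ x) = (φ x) ^ (-(k : ℤ)) * f x

end HessianQuotient

end

noncomputable section

namespace HessianQuotient

/-! The bounds on `φ` and `Dφ` follow from evenness and h-convexity, so one constant serves both (i)
and (ii). Along a great circle starting at a maximum, h-convexity becomes a Riccati-type inequality
giving `φ ≥ max φ / 2` up to angle π/2; evenness covers the other hemisphere. At a maximum `A[φ] >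
0` forces `φ > 1`. At a minimum `A[φ] ≥ (φ - 1/φ)/2`, and monotonicity of the quotient bounds `min
φ`, hence `φ` (`exists_c0_bound`). Since `φ''` is bounded below along great circles, `Dφ` is bounded
too (`IsSolution.norm_grad_le`).

For second derivatives, let `w` be the second derivative of `φ` along the rotations in a fixed
2-plane, and take a maximum `x` of `w`. Rotations are isometries, so differentiating `D²φ` twice in
a rotated frame gives `D²w ≤ 0`, and the corresponding second derivative of `Dφ` is `Dw = 0`
(`exists_rot_derivatives_at_max`). Since `log (σ_n / σ_{n-k})` lies below its tangent plane at
`A[φ](x)` (`log_sigma_quot_le`), the gap along the rotation orbit is nonnegative and vanishes at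
`x`, so its second derivative is nonnegative there (`IsSolution.rot_inequality`). The term
`-|Dφ|²/(2φ)` contributes a negative multiple of `w²`, weighted by the trace of the linearised
operator, which is bounded below; this bounds `w` (`exists_rot_bound`). For a unit eigenvector `e`
at `x`, the rotation in the plane of `x` and `e` has `w(x) = D²φ(e, e)`, which bounds the
eigenvalue. -/

/-- The ambient Euclidean space of the unit sphere `S^n`. -/
abbrev Amb (n : ℕ) : Type := EuclideanSpace ℝ (Fin (n + 1))

/-! ### Riemannian derivatives on the sphere through the degree-zero homogeneous extension -/

section RadialExtension

variable {n : ℕ} {φ : Sph n → ℝ}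

theorem radialExt_coe (φ : Sph n → ℝ) (x : Sph n) : radialExt φ (x : Amb n) = φ x := by
  have hx : ‖(x : Amb n)‖ = 1 := by simp
  have h0 : (x : Amb n) ≠ 0 := by
    intro h; rw [h] at hx; simp at hx
  rw [radialExt, dif_neg h0]
  congr 1
  ext1
  simp [hx]

theorem radialExt_smul (φ : Sph n → ℝ) {c : ℝ} (hc : 0 < c) (y : Amb n) :
    radialExt φ (c • y) = radialExt φ y := by
  by_cases h : y = 0
  · simp [h]
  · have h' : c • y ≠ 0 := smul_ne_zero hc.ne' h
    rw [radialExt, radialExt, dif_neg h, dif_neg h']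
    congr 1
    ext1
    change ‖c • y‖⁻¹ • c • y = ‖y‖⁻¹ • y
    rw [norm_smul, smul_smul, Real.norm_of_nonneg hc.le]
    congr 1
    field_simp

theorem radialExt_contDiffAt (hφ : ContMDiff (𝓡 n) 𝓘(ℝ, ℝ) ∞ φ) {y : Amb n} (hy : y ≠ 0) :
    ContDiffAt ℝ ∞ (radialExt φ) y := by
  have : Fact (Module.finrank ℝ (Amb n) = n + 1) := ⟨by simp⟩
  let U : TopologicalSpace.Opens (Amb n) := ⟨{0}ᶜ, isOpen_compl_singleton⟩
  have hU : ∀ z : U, (z : Amb n) ≠ 0 := fun z => z.2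
  have h1 : ContMDiff 𝓘(ℝ, Amb n) 𝓘(ℝ, Amb n) ∞ (fun z : U => ‖(z : Amb n)‖⁻¹ • (z : Amb n)) := by
    intro z
    refine (contMDiffAt_subtype_iff (f := fun z : Amb n => ‖z‖⁻¹ • z)).2 ?_
    refine ContDiffAt.contMDiffAt ?_
    exact ((contDiffAt_norm ℝ (hU z)).inv (norm_ne_zero_iff.2 (hU z))).smul contDiffAt_id
  have h2 : ∀ z : U, ‖(z : Amb n)‖⁻¹ • (z : Amb n) ∈ Metric.sphere (0 : Amb n) 1 := by
    intro z
    simp [norm_smul, hU z]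
  have h3 := hφ.comp (h1.codRestrict_sphere h2)
  have h4 := h3 ⟨y, hy⟩
  have h5 : (φ ∘ Set.codRestrict (fun z : U => ‖(z : Amb n)‖⁻¹ • (z : Amb n)) _ h2)
      = fun z : U => radialExt φ (z : Amb n) := by
    ext z
    rw [radialExt, dif_neg (hU z)]
    rfl
  rw [h5] at h4
  exact ((contMDiffAt_subtype_iff (x := (⟨y, hy⟩ : U))).1 h4).contDiffAt

theorem radialExt_pos (hpos : ∀ x, 0 < φ x) {y : Amb n} (hy : y ≠ 0) : 0 < radialExt φ y := by
  rw [radialExt, dif_neg hy]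
  exact hpos _

/-- Euler's relation in degree zero. It removes the radial acceleration terms of great circles and
rotations. -/
theorem fderiv_radialExt_self (hφ : ContMDiff (𝓡 n) 𝓘(ℝ, ℝ) ∞ φ) {y : Amb n} (hy : y ≠ 0) :
    fderiv ℝ (radialExt φ) y y = 0 := by
  have hd : DifferentiableAt ℝ (radialExt φ) y :=
    (radialExt_contDiffAt hφ hy).differentiableAt (by simp)
  have h1 : HasDerivAt (fun t : ℝ => (1 + t) • y) y 0 := by
    simpa using ((hasDerivAt_id (0 : ℝ)).const_add 1).smul_const y
  have h2 : HasDerivAt (fun t : ℝ => radialExt φ ((1 + t) • y)) (fderiv ℝ (radialExt φ) y y) 0 := by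
    have hd' : HasFDerivAt (radialExt φ) (fderiv ℝ (radialExt φ) y) ((1 + (0 : ℝ)) • y) := by
      simpa using hd.hasFDerivAt
    exact hd'.comp_hasDerivAt (0 : ℝ) h1
  have h3 : (fun t : ℝ => radialExt φ ((1 + t) • y)) =ᶠ[nhds 0] fun _ => radialExt φ y := by
    have : ∀ᶠ t : ℝ in nhds 0, -1 < t := lt_mem_nhds (by norm_num)
    filter_upwards [this] with t ht
    exact radialExt_smul φ (by linarith) y
  exact h2.unique ((hasDerivAt_const (0 : ℝ) (radialExt φ y)).congr_of_eventuallyEq h3)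

theorem contDiffAt_fderiv_of_contDiffAt_top {E F : Type*} [NormedAddCommGroup E] [NormedSpace ℝ E]
    [NormedAddCommGroup F] [NormedSpace ℝ F] {g : E → F} {y : E}
    (h : ContDiffAt ℝ ∞ g y) : ContDiffAt ℝ ∞ (fderiv ℝ g) y :=
  h.fderiv_right (m := ∞) (by simp)

theorem inner_gradient (g : Amb n → ℝ) (y v : Amb n) :
    inner ℝ (gradient g y) v = fderiv ℝ g y v := by
  rw [gradient, InnerProductSpace.toDual_symm_apply]

theorem norm_gradient (g : Amb n → ℝ) (y : Amb n) : ‖gradient g y‖ = ‖fderiv ℝ g y‖ := by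
  rw [gradient, LinearIsometryEquiv.norm_map]

theorem inner_fderiv_gradient {g : Amb n → ℝ} {y : Amb n} (h : ContDiffAt ℝ ∞ g y) (v u : Amb n) :
    inner ℝ (fderiv ℝ (gradient g) y v) u = fderiv ℝ (fderiv ℝ g) y v u := by
  have hd : DifferentiableAt ℝ (fderiv ℝ g) y :=
    (contDiffAt_fderiv_of_contDiffAt_top h).differentiableAt (by simp)
  have hg : DifferentiableAt ℝ (gradient g) y := by
    rw [differentiableAt_euclidean]
    intro i
    have : (fun z => gradient g z i) = fun z => fderiv ℝ g z (EuclideanSpace.single i 1) := by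
      ext z
      rw [← inner_gradient, EuclideanSpace.inner_single_right]
      simp
    rw [this]
    exact hd.clm_apply (differentiableAt_const _)
  have e : (fun z => inner ℝ (gradient g z) u) = fun z => fderiv ℝ g z u := by
    ext z; exact inner_gradient g z u
  have h1 := (hg.hasFDerivAt.inner ℝ (hasFDerivAt_const u y))
  have h2 := hd.hasFDerivAt.clm_apply (hasFDerivAt_const u y)
  rw [e] at h1
  have := congrArg (fun L => L v) (h1.unique h2)
  simpa [fderivInnerCLM_apply] using this

theorem coe_ne_zero (x : Sph n) : (x : Amb n) ≠ 0 := by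
  intro h
  have := x.2
  simp [h] at this

theorem inner_hess (hφ : ContMDiff (𝓡 n) 𝓘(ℝ, ℝ) ∞ φ) (x : Sph n) (v u : Tan x) :
    inner ℝ (hess φ x v) u = fderiv ℝ (fderiv ℝ (radialExt φ)) (x : Amb n) v u := by
  rw [← inner_fderiv_gradient (radialExt_contDiffAt hφ (coe_ne_zero x))]
  simp [hess]

theorem norm_grad (φ : Sph n → ℝ) (x : Sph n) :
    ‖grad φ x‖ = ‖fderiv ℝ (radialExt φ) (x : Amb n)‖ := norm_gradient _ _

theorem inner_A (hφ : ContMDiff (𝓡 n) 𝓘(ℝ, ℝ) ∞ φ) (x : Sph n) (v u : Tan x) :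
    inner ℝ (A φ x v) u = fderiv ℝ (fderiv ℝ (radialExt φ)) (x : Amb n) v u
      + (-(‖grad φ x‖ ^ 2 / (2 * φ x)) + (φ x - 1 / φ x) / 2) * inner ℝ v u := by
  rw [← inner_hess hφ]
  simp only [A, LinearMap.add_apply, LinearMap.sub_apply, LinearMap.smul_apply, LinearMap.id_apply,
    inner_add_left, inner_sub_left, real_inner_smul_left]
  ring

theorem A_isSymmetric (hφ : ContMDiff (𝓡 n) 𝓘(ℝ, ℝ) ∞ φ) (x : Sph n) :
    (A φ x).IsSymmetric := by
  intro v u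
  have hs : IsSymmSndFDerivAt ℝ (radialExt φ) (x : Amb n) :=
    (radialExt_contDiffAt hφ (coe_ne_zero x)).isSymmSndFDerivAt
      (by simp only [minSmoothness_of_isRCLikeNormedField]; exact WithTop.coe_le_coe.2 (le_top (a := (2 : ℕ∞))))
  rw [real_inner_comm (A φ x u) v, inner_A hφ, inner_A hφ, real_inner_comm, hs.eq]

theorem finrank_tan (x : Sph n) : Module.finrank ℝ (Tan x) = n := by
  have : Fact (Module.finrank ℝ (Amb n) = n + 1) := ⟨by simp⟩
  exact Submodule.finrank_orthogonal_span_singleton (coe_ne_zero x)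

theorem mem_tan_iff (x : Sph n) (v : Amb n) : v ∈ Tan x ↔ inner ℝ (x : Amb n) v = 0 :=
  Submodule.mem_orthogonal_singleton_iff_inner_right

theorem grad_mem_tan (hφ : ContMDiff (𝓡 n) 𝓘(ℝ, ℝ) ∞ φ) (x : Sph n) : grad φ x ∈ Tan x := by
  rw [mem_tan_iff, real_inner_comm, grad, inner_gradient,
    fderiv_radialExt_self hφ (coe_ne_zero x)]

theorem norm_sq_grad (hφ : ContMDiff (𝓡 n) 𝓘(ℝ, ℝ) ∞ φ) (x : Sph n) {ι : Type*} [Fintype ι]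
    (b : OrthonormalBasis ι ℝ (Tan x)) :
    ‖grad φ x‖ ^ 2 = ∑ i, (fderiv ℝ (radialExt φ) (x : Amb n) (b i)) ^ 2 := by
  have h := b.sum_sq_norm_inner_right ⟨grad φ x, grad_mem_tan hφ x⟩
  have h2 : ‖(⟨grad φ x, grad_mem_tan hφ x⟩ : Tan x)‖ = ‖grad φ x‖ := rfl
  rw [h2] at h
  rw [← h]
  refine Finset.sum_congr rfl fun i _ => ?_
  rw [Real.norm_eq_abs, sq_abs, ← inner_gradient, real_inner_comm]
  rfl

end RadialExtension

/-! ### Concavity of the logarithm of the Hessian quotient -/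

section LinearAlgebra

variable {n : ℕ}

/-- The `j`-th elementary symmetric function of the entries of `l`. -/
def esym (j : ℕ) (l : Fin n → ℝ) : ℝ :=
  ∑ J ∈ Finset.powersetCard j Finset.univ, ∏ i ∈ J, l i

/-- The partial derivatives of `log (esym n / esym j)`. -/
def dlogQuot (j : ℕ) (l : Fin n → ℝ) (i : Fin n) : ℝ :=
  (∑ J ∈ Finset.powersetCard j Finset.univ, if i ∈ J then 0 else ∏ a ∈ J, l a)
    / (l i * esym j l)

theorem esym_pos {j : ℕ} (hj : j ≤ n) {l : Fin n → ℝ} (hl : ∀ i, 0 < l i) : 0 < esym j l := by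
  refine Finset.sum_pos (fun J _ => Finset.prod_pos fun i _ => hl i) ?_
  rw [Finset.powersetCard_nonempty]
  simpa using hj

theorem esym_card (l : Fin n → ℝ) : esym n l = ∏ i, l i := by
  have : Finset.powersetCard n (Finset.univ : Finset (Fin n)) = {Finset.univ} := by
    simpa using Finset.powersetCard_self (Finset.univ : Finset (Fin n))
  rw [esym, this, Finset.sum_singleton]

theorem esym_const (j : ℕ) (s : ℝ) : esym j (fun _ : Fin n => s) = n.choose j * s ^ j := by
  rw [esym, Finset.sum_congr rfl (g := fun _ => s ^ j)]
  · simp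
  · intro J hJ
    rw [Finset.prod_const, (Finset.mem_powersetCard.1 hJ).2]

theorem esym_const_quot {j : ℕ} (hj : j ≤ n) {s : ℝ} (hs : 0 < s) :
    esym n (fun _ : Fin n => s) / esym j (fun _ : Fin n => s) = s ^ (n - j) / n.choose j := by
  rw [esym_const, esym_const, Nat.choose_self]
  have : s ^ n = s ^ (n - j) * s ^ j := by rw [← pow_add, Nat.sub_add_cancel hj]
  rw [this]
  have : ((n.choose j : ℕ) : ℝ) ≠ 0 := by exact_mod_cast (Nat.choose_pos hj).ne'
  field_simp
  simp

theorem esym_comp_perm (j : ℕ) (l : Fin n → ℝ) (σ : Equiv.Perm (Fin n)) :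
    esym j (l ∘ σ) = esym j l := by
  rw [esym, ← Finset.esymm_map_val, esym, ← Finset.esymm_map_val]
  congr 1
  have : Multiset.map σ (Finset.univ : Finset (Fin n)).val = (Finset.univ : Finset (Fin n)).val := by
    simp
  conv_rhs => rw [← this, Multiset.map_map]

theorem dlogQuot_nonneg {j : ℕ} (hj : j ≤ n) {l : Fin n → ℝ} (hl : ∀ i, 0 < l i) (i : Fin n) :
    0 ≤ dlogQuot j l i := by
  refine div_nonneg (Finset.sum_nonneg fun J _ => ?_) (mul_pos (hl i) (esym_pos hj hl)).le
  split_ifs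
  · exact le_rfl
  · exact Finset.prod_nonneg fun a _ => (hl a).le

/-- Regrouping by `J` turns the differential into an average with weights `∏_J l / esym j l`, the
form matched by Jensen's inequality in `log_quot_le`. -/
theorem sum_dlogQuot_mul {j : ℕ} {l : Fin n → ℝ} (hl : ∀ i, 0 < l i) (m : Fin n → ℝ) :
    ∑ i, dlogQuot j l i * m i =
      ∑ J ∈ Finset.powersetCard j (Finset.univ : Finset (Fin n)),
        ((∏ a ∈ J, l a) / esym j l) * ∑ i ∈ Jᶜ, m i / l i := by
  simp only [dlogQuot, Finset.sum_div, Finset.sum_mul, Finset.mul_sum]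
  rw [Finset.sum_comm]
  refine Finset.sum_congr rfl fun J _ => ?_
  rw [← Finset.sum_filter_add_sum_filter_not Finset.univ (fun i => i ∈ J)]
  rw [Finset.sum_eq_zero (s := Finset.filter (fun i => i ∈ J) Finset.univ), zero_add]
  · refine Finset.sum_congr ?_ fun i hi => ?_
    · ext; simp
    · rw [if_neg (by simpa using hi)]
      have := (hl i).ne'
      by_cases h : esym j l = 0
      · simp [h]
      · field_simp
  · intro i hi
    rw [if_pos (by simpa using hi)]
    simp

/-- Euler's identity: the quotient is homogeneous of degree `n - j`. -/
theorem sum_dlogQuot_mul_self {j : ℕ} (hj : j ≤ n) {l : Fin n → ℝ} (hl : ∀ i, 0 < l i) :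
    ∑ i, dlogQuot j l i * l i = (n - j : ℕ) := by
  rw [sum_dlogQuot_mul hl]
  have h : ∀ J ∈ Finset.powersetCard j (Finset.univ : Finset (Fin n)),
      ((∏ a ∈ J, l a) / esym j l) * ∑ i ∈ Jᶜ, l i / l i
        = ((∏ a ∈ J, l a) / esym j l) * (n - j : ℕ) := by
    intro J hJ
    congr 1
    rw [Finset.sum_congr rfl (g := fun _ => (1 : ℝ)) (fun i _ => div_self (hl i).ne')]
    simp [Finset.card_compl, (Finset.mem_powersetCard.1 hJ).2]
  rw [Finset.sum_congr rfl h, ← Finset.sum_mul, ← Finset.sum_div, ← esym,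
    div_self (esym_pos hj hl).ne', one_mul]

/-- The tangent plane inequality for the concave function `log (esym n / esym j)`. -/
theorem log_quot_le {j : ℕ} (hj : j ≤ n) {l m : Fin n → ℝ} (hl : ∀ i, 0 < l i)
    (hm : ∀ i, 0 < m i) :
    Real.log (esym n m / esym j m) ≤
      Real.log (esym n l / esym j l) + ∑ i, dlogQuot j l i * (m i - l i) := by
  set S := Finset.powersetCard j (Finset.univ : Finset (Fin n)) with hS
  have hEl := esym_pos hj hl
  have hEm := esym_pos hj hm
  have hPl : 0 < esym n l := esym_pos le_rfl hl
  have hPm : 0 < esym n m := esym_pos le_rfl hm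
  have hprod : ∀ (g : Fin n → ℝ) (J : Finset (Fin n)), (∏ i, g i) = (∏ i ∈ J, g i) * ∏ i ∈ Jᶜ, g i :=
    fun g J => (Finset.prod_mul_prod_compl J g).symm
  -- With these weights the ratio of the quotient at `l` to that at `m` is the average of the `r J`.
  -- Jensen for `log`, then `log u ≤ u - 1` in each factor, gives the tangent plane.
  let θ : Finset (Fin n) → ℝ := fun J => (∏ a ∈ J, l a) / esym j l
  let r : Finset (Fin n) → ℝ := fun J => ∏ i ∈ Jᶜ, l i / m i
  have hθ : ∀ J ∈ S, 0 ≤ θ J := fun J _ => div_nonneg (Finset.prod_nonneg fun a _ => (hl a).le) hEl.le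
  have hθ1 : ∑ J ∈ S, θ J = 1 := by
    rw [← Finset.sum_div]; exact div_self hEl.ne'
  have hr : ∀ J ∈ S, r J ∈ Set.Ioi (0 : ℝ) := fun J _ => Finset.prod_pos fun i _ => div_pos (hl i) (hm i)
  have hJ := strictConcaveOn_log_Ioi.concaveOn.le_map_sum hθ hθ1 hr
  have hsum : ∑ J ∈ S, θ J • r J = (esym n l / esym j l) / (esym n m / esym j m) := by
    have : ∀ J ∈ S, θ J • r J = (esym n l / (esym j l * esym n m)) * ∏ i ∈ J, m i := by
      intro J _
      have hmc : (∏ i ∈ Jᶜ, m i) ≠ 0 := (Finset.prod_pos fun i _ => hm i).ne'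
      have hmJ : (∏ i ∈ J, m i) ≠ 0 := (Finset.prod_pos fun i _ => hm i).ne'
      simp only [θ, r, smul_eq_mul, Finset.prod_div_distrib]
      rw [esym_card, esym_card, hprod l J, hprod m J]
      field_simp
    rw [Finset.sum_congr rfl this, ← Finset.mul_sum]
    change _ * esym j m = _
    field_simp
  rw [hsum, Real.log_div (div_pos hPl hEl).ne' (div_pos hPm hEm).ne'] at hJ
  have hlow : -∑ i, dlogQuot j l i * (m i - l i) ≤ ∑ J ∈ S, θ J • Real.log (r J) := by
    rw [sum_dlogQuot_mul hl, ← Finset.sum_neg_distrib]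
    refine Finset.sum_le_sum fun J hJS => ?_
    rw [smul_eq_mul, ← mul_neg]
    refine mul_le_mul_of_nonneg_left ?_ (hθ J hJS)
    rw [Real.log_prod (fun i _ => (div_pos (hl i) (hm i)).ne'), ← Finset.sum_neg_distrib]
    refine Finset.sum_le_sum fun i _ => ?_
    have h1 := Real.log_le_sub_one_of_pos (div_pos (hm i) (hl i))
    have h2 : Real.log (l i / m i) = -Real.log (m i / l i) := by rw [← Real.log_inv, inv_div]
    have h3 : (m i - l i) / l i = m i / l i - 1 := by
      rw [sub_div, div_self (hl i).ne']
    rw [h2, h3]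
    linarith
  linarith

variable {V : Type*} [NormedAddCommGroup V] [InnerProductSpace ℝ V] [FiniteDimensional ℝ V]

theorem sigma_eq_esym {T : V →ₗ[ℝ] V} (b : OrthonormalBasis (Fin n) ℝ V) {l : Fin n → ℝ}
    (h : ∀ i, T (b i) = l i • b i) (j : ℕ) : sigma j T = esym j l := by
  have hM : LinearMap.toMatrix b.toBasis b.toBasis T = Matrix.diagonal l := by
    ext i k
    rw [LinearMap.toMatrix_apply]
    simp only [OrthonormalBasis.coe_toBasis, h, map_smul, Finsupp.smul_apply, smul_eq_mul,
      Matrix.diagonal_apply]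
    rw [show b k = b.toBasis k by simp, Module.Basis.repr_self, Finsupp.single_apply]
    by_cases hik : i = k
    · simp [hik]
    · simp [hik, Ne.symm hik]
  have hc : T.charpoly = ∏ i, (Polynomial.X - Polynomial.C (l i)) := by
    rw [← LinearMap.charpoly_toMatrix T b.toBasis, hM, Matrix.charpoly_diagonal]
  have hr : (∏ i, (Polynomial.X - Polynomial.C (l i))).roots = Finset.univ.val.map l := by
    rw [← Polynomial.roots_multiset_prod_X_sub_C (Finset.univ.val.map l), Multiset.map_map]
    rfl
  rw [sigma, hc, hr, Finset.esymm_map_val]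
  rfl

/-- The tangent plane inequality for `log (σ_n / σ_j)` on positive definite symmetric
endomorphisms, at a diagonal one. -/
theorem log_sigma_quot_le (hn : Module.finrank ℝ V = n) {T : V →ₗ[ℝ] V} (hT : T.IsSymmetric)
    (hpos : ∀ v, v ≠ 0 → 0 < inner ℝ (T v) v) (e : OrthonormalBasis (Fin n) ℝ V) {j : ℕ}
    (hj : j ≤ n) {l : Fin n → ℝ} (hl : ∀ i, 0 < l i) :
    Real.log (sigma n T / sigma j T) ≤
      Real.log (esym n l / esym j l) + ∑ i, dlogQuot j l i * (inner ℝ (T (e i)) (e i) - l i) := by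
  let b := hT.eigenvectorBasis hn
  let μ := hT.eigenvalues hn
  have hb : ∀ i, T (b i) = μ i • b i := fun i => hT.apply_eigenvectorBasis hn i
  have hμ : ∀ i, 0 < μ i := by
    intro i
    have := hpos (b i) (b.orthonormal.ne_zero i)
    rwa [hb, real_inner_smul_left, real_inner_self_eq_norm_sq, b.orthonormal.1, one_pow,
      mul_one] at this
  -- The diagonal of `T` in the basis `e` is `D` applied to the eigenvalues. Birkhoff's theorem
  -- makes it an average of permutations of them, so the scalar inequality, valid for each
  -- permutation by symmetry, can be averaged.
  let D : Matrix (Fin n) (Fin n) ℝ := fun i k => inner ℝ (e i) (b k) ^ 2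
  have hD : D ∈ doublyStochastic ℝ (Fin n) := by
    rw [mem_doublyStochastic_iff_sum]
    refine ⟨fun i k => sq_nonneg _, fun i => ?_, fun k => ?_⟩
    · have := b.sum_sq_norm_inner_left (e i)
      simpa [D, e.orthonormal.1] using this
    · have := e.sum_sq_norm_inner_right (b k)
      simpa [D, b.orthonormal.1] using this
  obtain ⟨w, hw0, hw1, hw⟩ := exists_eq_sum_perm_of_mem_doublyStochastic hD
  have hdiag : ∀ i, inner ℝ (T (e i)) (e i) = ∑ σ, w σ * μ (σ i) := by
    intro i
    have h1 : inner ℝ (T (e i)) (e i) = ∑ k, D i k * μ k := by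
      rw [← b.sum_inner_mul_inner]
      refine Finset.sum_congr rfl fun k _ => ?_
      rw [hT, hb, real_inner_smul_right, real_inner_comm (e i) (b k)]
      simp only [D]
      ring
    rw [h1, ← hw]
    simp only [Matrix.sum_apply, Matrix.smul_apply, smul_eq_mul, Finset.sum_mul]
    rw [Finset.sum_comm]
    refine Finset.sum_congr rfl fun σ _ => ?_
    simp [Equiv.Perm.permMatrix, PEquiv.toMatrix_apply, Equiv.toPEquiv_apply]
  have hperm : ∀ σ : Equiv.Perm (Fin n), Real.log (sigma n T / sigma j T) ≤
      Real.log (esym n l / esym j l) + ∑ i, dlogQuot j l i * (μ (σ i) - l i) := by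
    intro σ
    have := log_quot_le hj hl (m := μ ∘ σ) (fun i => hμ _)
    rw [esym_comp_perm, esym_comp_perm, ← sigma_eq_esym b hb, ← sigma_eq_esym b hb] at this
    exact this
  calc Real.log (sigma n T / sigma j T)
      = ∑ σ, w σ * Real.log (sigma n T / sigma j T) := by rw [← Finset.sum_mul, hw1, one_mul]
    _ ≤ ∑ σ, w σ * (Real.log (esym n l / esym j l) + ∑ i, dlogQuot j l i * (μ (σ i) - l i)) :=
        Finset.sum_le_sum fun σ _ => mul_le_mul_of_nonneg_left (hperm σ) (hw0 σ)
    _ = _ := by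
        simp only [mul_add, Finset.sum_add_distrib]
        rw [← Finset.sum_mul, hw1, one_mul]
        congr 1
        simp only [Finset.mul_sum]
        rw [Finset.sum_comm]
        refine Finset.sum_congr rfl fun i _ => ?_
        rw [hdiag, mul_sub, Finset.mul_sum]
        simp only [mul_sub, Finset.sum_sub_distrib]
        congr 1
        · exact Finset.sum_congr rfl fun σ _ => by ring
        · rw [← Finset.sum_mul, hw1, one_mul]

/-- A lower bound for the trace of the linearisation of `log (esym n / esym j)`. -/
theorem le_sum_dlogQuot {j : ℕ} (hj : j ≤ n) {l : Fin n → ℝ} (hl : ∀ i, 0 < l i) {s : ℝ}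
    (hs : 0 < s)
    (h : Real.log (esym n l / esym j l) ≤ Real.log (s ^ (n - j) / n.choose j)) :
    ((n - j : ℕ) : ℝ) / s ≤ ∑ i, dlogQuot j l i := by
  -- Test the tangent plane at `l` on the constant vector `s`; Euler's identity evaluates the term
  -- in `l`.
  have h1 := log_quot_le hj hl (m := fun _ => s) (fun _ => hs)
  rw [esym_const_quot hj hs] at h1
  simp only [mul_sub, Finset.sum_sub_distrib] at h1
  rw [sum_dlogQuot_mul_self hj hl, ← Finset.sum_mul] at h1
  rw [div_le_iff₀ hs]
  linarith

/-- Monotonicity of `esym n / esym j` compared with a constant. -/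
theorem log_quot_const_le {j : ℕ} (hj : j ≤ n) {l : Fin n → ℝ} {s : ℝ} (hs : 0 < s)
    (h : ∀ i, s ≤ l i) :
    Real.log (s ^ (n - j) / n.choose j) ≤ Real.log (esym n l / esym j l) := by
  have hl : ∀ i, 0 < l i := fun i => hs.trans_le (h i)
  have h1 := log_quot_le hj hl (m := fun _ => s) (fun _ => hs)
  rw [esym_const_quot hj hs] at h1
  refine h1.trans ?_
  have : ∑ i, dlogQuot j l i * (s - l i) ≤ 0 :=
    Finset.sum_nonpos fun i _ =>
      mul_nonpos_of_nonneg_of_nonpos (dlogQuot_nonneg hj hl i) (by linarith [h i])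
  linarith

end LinearAlgebra

/-! ### Second-derivative tests and comparison along a great circle -/

section OneVariable

/-- If `c` were negative, 0 would also be a local maximum, so `h` would be locally constant and `c =
0`. -/
theorem nonneg_of_isLocalMin_of_hasDerivAt {h h1 : ℝ → ℝ} {c : ℝ} (hh : ∀ t, HasDerivAt h (h1 t) t)
    (hh1 : HasDerivAt h1 c 0) (hmin : IsLocalMin h 0) : 0 ≤ c := by
  by_contra! hc
  have hd : deriv h = h1 := funext fun t => (hh t).deriv
  have h0 : h1 0 = 0 := hmin.hasDerivAt_eq_zero (hh 0)
  have hmax : IsLocalMax h 0 :=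
    isLocalMax_of_deriv_deriv_neg (by rw [hd, hh1.deriv]; exact hc) (by rw [hd, h0])
      (hh 0).continuousAt
  have hconst : h =ᶠ[nhds 0] fun _ => h 0 := by
    filter_upwards [hmin, hmax] with t h1 h2 using le_antisymm h2 h1
  have h2 : deriv h =ᶠ[nhds 0] fun _ => 0 := by
    filter_upwards [hconst.eventuallyEq_nhds] with t ht
    rw [ht.deriv_eq, deriv_const]
  rw [hd] at h2
  have := (hh1.congr_of_eventuallyEq h2.symm).unique (hasDerivAt_const (0 : ℝ) (0 : ℝ))
  exact hc.ne this

theorem nonpos_of_isLocalMax_of_hasDerivAt {h h1 : ℝ → ℝ} {c : ℝ} (hh : ∀ t, HasDerivAt h (h1 t) t)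
    (hh1 : HasDerivAt h1 c 0) (hmax : IsLocalMax h 0) : c ≤ 0 := by
  have := nonneg_of_isLocalMin_of_hasDerivAt (fun t => (hh t).neg) hh1.neg hmax.neg
  linarith

theorem monotoneOn_of_hasDerivAt_nonneg {D : Set ℝ} (hD : Convex ℝ D) {h h1 : ℝ → ℝ}
    (hh : ∀ t ∈ D, HasDerivAt h (h1 t) t) (hn : ∀ t ∈ D, 0 ≤ h1 t) : MonotoneOn h D := by
  refine monotoneOn_of_deriv_nonneg hD (fun t ht => (hh t ht).continuousAt.continuousWithinAt)
    (fun t ht => (hh t (interior_subset ht)).differentiableAt.differentiableWithinAt) ?_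
  intro t ht
  rw [(hh t (interior_subset ht)).deriv]
  exact hn t (interior_subset ht)

/-- The comparison argument for uniformly h-convex functions on a great circle, starting at a
critical point. -/
theorem half_le_of_hconvex_ode {p p1 p2 : ℝ → ℝ} (hp : ∀ t, HasDerivAt p (p1 t) t)
    (hp1 : ∀ t, HasDerivAt p1 (p2 t) t) (hpos : ∀ t, 0 < p t)
    (hode : ∀ t, p1 t ^ 2 / (2 * p t) - (p t - 1 / p t) / 2 < p2 t) (h0 : p1 0 = 0) {t : ℝ}
    (ht0 : 0 ≤ t) (ht : t ≤ Real.pi / 2) : p 0 / 2 ≤ p t := by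
  have hcos : ∀ s ∈ Set.Icc 0 (Real.pi / 2), 0 ≤ Real.cos s := fun s hs =>
    Real.cos_nonneg_of_mem_Icc ⟨by linarith [hs.1, Real.pi_pos], hs.2⟩
  have hc : ∀ s ∈ Set.Icc 0 (Real.pi / 2), 0 < 1 + Real.cos s := fun s hs => by
    linarith [hcos s hs]
  -- The function is `tan (s/2)`, a solution of `τ' = (1 + τ²)/2`.
  have hτ : ∀ s ∈ Set.Icc 0 (Real.pi / 2),
      HasDerivAt (fun s => Real.sin s / (1 + Real.cos s)) (1 / (1 + Real.cos s)) s := by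
    intro s hs
    have h := (Real.hasDerivAt_sin s).div ((Real.hasDerivAt_cos s).const_add 1) (hc s hs).ne'
    refine h.congr_deriv ?_
    have := hc s hs
    rw [div_eq_div_iff (by positivity) this.ne']
    linear_combination (1 + Real.cos s) * Real.sin_sq_add_cos_sq s
  -- With `q = p' + p τ`, completing the square gives `q' ≥ (q² + 1)/(2p)`, so `q ≥ q 0 = 0`. This
  -- is the sign of the derivative of `p / (1 + cos)`, whence `p t ≥ p 0 (1 + cos t)/2`.
  have hq : MonotoneOn (fun s => p1 s + p s * (Real.sin s / (1 + Real.cos s)))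
      (Set.Icc 0 (Real.pi / 2)) := by
    refine monotoneOn_of_hasDerivAt_nonneg (convex_Icc _ _)
      (fun s hs => (hp1 s).add ((hp s).mul (hτ s hs))) fun s hs => ?_
    have h1 := hode s
    have hps := hpos s
    set τ := Real.sin s / (1 + Real.cos s) with hτdef
    have h2 : 1 / (1 + Real.cos s) = (1 + τ ^ 2) / 2 := by
      have := hc s hs
      rw [hτdef]
      field_simp
      linarith [Real.sin_sq_add_cos_sq s]
    rw [h2]
    have h3 : p1 s ^ 2 / (2 * p s) - (p s - 1 / p s) / 2 + (p1 s * τ + p s * ((1 + τ ^ 2) / 2))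
        = ((p1 s + p s * τ) ^ 2 + 1) / (2 * p s) := by
      field_simp
      ring
    have h4 : 0 ≤ ((p1 s + p s * τ) ^ 2 + 1) / (2 * p s) := by positivity
    linarith
  have hr : MonotoneOn (fun s => p s / (1 + Real.cos s)) (Set.Icc 0 (Real.pi / 2)) := by
    refine monotoneOn_of_hasDerivAt_nonneg (convex_Icc _ _)
      (fun s hs => (hp s).div ((Real.hasDerivAt_cos s).const_add 1) (hc s hs).ne') fun s hs => ?_
    have h1 := hq (Set.left_mem_Icc.2 (by positivity)) hs hs.1
    simp only [h0, Real.sin_zero, zero_div, mul_zero, add_zero] at h1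
    have h2 := hc s hs
    refine div_nonneg ?_ (sq_nonneg _)
    have h3 : p1 s * (1 + Real.cos s) - p s * -Real.sin s
        = (p1 s + p s * (Real.sin s / (1 + Real.cos s))) * (1 + Real.cos s) := by
      field_simp
      ring
    rw [h3]
    exact mul_nonneg h1 h2.le
  have h1 := hr (Set.left_mem_Icc.2 (by positivity)) ⟨ht0, ht⟩ ht0
  simp only [Real.cos_zero] at h1
  rw [le_div_iff₀ (hc t ⟨ht0, ht⟩)] at h1
  have h2 := hcos t ⟨ht0, ht⟩
  have h3 := hpos 0
  norm_num at h1
  nlinarith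

/-- The inequality forces `p'' ≥ -M/2`. Integrating twice over `[0, 1]` gives `p' 0 ≤ p 1 - p 0 +
M/4`, and `0 < p ≤ M` does the rest. -/
theorem deriv_le_of_hconvex_ode {p p1 p2 : ℝ → ℝ} {M : ℝ} (hp : ∀ t, HasDerivAt p (p1 t) t)
    (hp1 : ∀ t, HasDerivAt p1 (p2 t) t) (hpos : ∀ t, 0 < p t)
    (hode : ∀ t, p1 t ^ 2 / (2 * p t) - (p t - 1 / p t) / 2 < p2 t) (hM : ∀ t, p t ≤ M) :
    p1 0 ≤ 2 * M := by
  have hp2 : ∀ t, -(M / 2) ≤ p2 t := by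
    intro t
    have h1 := hode t
    have h2 := hpos t
    have h3 : 0 ≤ p1 t ^ 2 / (2 * p t) := by positivity
    have h4 : 0 ≤ 1 / p t := by positivity
    have := hM t
    linarith
  have hm1 : MonotoneOn (fun t => p1 t + M / 2 * t) Set.univ :=
    monotoneOn_of_hasDerivAt_nonneg convex_univ
      (fun t _ => (hp1 t).add ((hasDerivAt_id t).const_mul (M / 2))) fun t _ => by
        linarith [hp2 t]
  have hm : MonotoneOn (fun t => p t - p1 0 * t + M / 4 * t ^ 2) (Set.Icc 0 1) := by
    refine monotoneOn_of_hasDerivAt_nonneg (convex_Icc _ _)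
      (fun t _ => ((hp t).sub ((hasDerivAt_id t).const_mul (p1 0))).add
        ((hasDerivAt_pow 2 t).const_mul (M / 4))) fun t ht => ?_
    have := hm1 (Set.mem_univ 0) (Set.mem_univ t) ht.1
    simp only [mul_zero, add_zero] at this
    norm_num
    linarith
  have h := hm (Set.left_mem_Icc.2 zero_le_one) (Set.right_mem_Icc.2 zero_le_one) zero_le_one
  norm_num at h
  linarith [hpos 0, hM 0, hM 1]

end OneVariable

/-! ### Restriction of the Hessian and of h-convexity to great circles -/

section GreatCircles

variable {n : ℕ}

/-- The curve `cos s • x + sin s • e`. -/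
def circ (x e : Amb n) (s : ℝ) : Amb n := Real.cos s • x + Real.sin s • e

theorem circ_zero (x e : Amb n) : circ x e 0 = x := by simp [circ]

theorem hasDerivAt_circ (x e : Amb n) (s : ℝ) : HasDerivAt (circ x e) (circ e (-x) s) s := by
  have h := ((Real.hasDerivAt_cos s).smul_const x).add ((Real.hasDerivAt_sin s).smul_const e)
  refine h.congr_deriv ?_
  simp only [circ, smul_neg, neg_smul]
  abel

theorem circ_neg_neg (x e : Amb n) (s : ℝ) : circ (-x) (-e) s = -circ x e s := by
  simp only [circ, smul_neg]
  abel

theorem norm_circ {x e : Amb n} (hx : ‖x‖ = 1) (he : ‖e‖ = 1) (hxe : inner ℝ x e = 0) (s : ℝ) :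
    ‖circ x e s‖ = 1 := by
  have h : ‖circ x e s‖ ^ 2 = 1 := by
    rw [← real_inner_self_eq_norm_sq]
    simp only [circ, inner_add_left, inner_add_right, real_inner_smul_left, real_inner_smul_right,
      real_inner_self_eq_norm_sq, norm_smul, mul_pow, Real.norm_eq_abs, sq_abs, hx, he, hxe,
      real_inner_comm x e]
    linarith [Real.sin_sq_add_cos_sq s]
  nlinarith [norm_nonneg (circ x e s)]

theorem inner_circ {x e : Amb n} (hx : ‖x‖ = 1) (he : ‖e‖ = 1) (hxe : inner ℝ x e = 0) (s : ℝ) :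
    inner ℝ (circ x e s) (circ e (-x) s) = 0 := by
  simp only [circ, inner_add_left, inner_add_right, real_inner_smul_left, real_inner_smul_right,
    real_inner_self_eq_norm_sq, hx, he, hxe, real_inner_comm x e, inner_neg_right]
  ring

theorem ne_zero_of_norm_eq_one {y : Amb n} (hy : ‖y‖ = 1) : y ≠ 0 := by
  intro h; simp [h] at hy

theorem hasDerivAt_comp_curve {g : Amb n → ℝ} {γ : ℝ → Amb n} {γ' : Amb n} {s : ℝ}
    (hg : ContDiffAt ℝ ∞ g (γ s)) (hγ : HasDerivAt γ γ' s) :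
    HasDerivAt (fun s => g (γ s)) (fderiv ℝ g (γ s) γ') s :=
  (hg.differentiableAt (by simp)).hasFDerivAt.comp_hasDerivAt s hγ

theorem hasDerivAt_fderiv_comp_curve {g : Amb n → ℝ} {γ δ : ℝ → Amb n} {γ' δ' : Amb n} {s : ℝ}
    (hg : ContDiffAt ℝ ∞ g (γ s)) (hγ : HasDerivAt γ γ' s) (hδ : HasDerivAt δ δ' s) :
    HasDerivAt (fun s => fderiv ℝ g (γ s) (δ s))
      (fderiv ℝ (fderiv ℝ g) (γ s) γ' (δ s) + fderiv ℝ g (γ s) δ') s := by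
  have h : HasDerivAt (fun s => fderiv ℝ g (γ s)) (fderiv ℝ (fderiv ℝ g) (γ s) γ') s :=
    ((contDiffAt_fderiv_of_contDiffAt_top hg).differentiableAt (by simp)).hasFDerivAt.comp_hasDerivAt
      s hγ
  exact h.clm_apply hδ

variable {φ : Sph n → ℝ}

theorem hasDerivAt_radialExt_circ (hφ : ContMDiff (𝓡 n) 𝓘(ℝ, ℝ) ∞ φ) {x e : Amb n}
    (hx : ‖x‖ = 1) (he : ‖e‖ = 1) (hxe : inner ℝ x e = 0) (s : ℝ) :
    HasDerivAt (fun s => radialExt φ (circ x e s))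
      (fderiv ℝ (radialExt φ) (circ x e s) (circ e (-x) s)) s :=
  hasDerivAt_comp_curve
    (radialExt_contDiffAt hφ (ne_zero_of_norm_eq_one (norm_circ hx he hxe s))) (hasDerivAt_circ x e s)

/-- The acceleration of a great circle is radial, so its contribution vanishes and only the Hessian
term remains. -/
theorem hasDerivAt_fderiv_radialExt_circ (hφ : ContMDiff (𝓡 n) 𝓘(ℝ, ℝ) ∞ φ) {x e : Amb n}
    (hx : ‖x‖ = 1) (he : ‖e‖ = 1) (hxe : inner ℝ x e = 0) (s : ℝ) :
    HasDerivAt (fun s => fderiv ℝ (radialExt φ) (circ x e s) (circ e (-x) s))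
      (fderiv ℝ (fderiv ℝ (radialExt φ)) (circ x e s) (circ e (-x) s) (circ e (-x) s)) s := by
  have h0 := ne_zero_of_norm_eq_one (norm_circ hx he hxe s)
  have h := hasDerivAt_fderiv_comp_curve (radialExt_contDiffAt hφ h0) (hasDerivAt_circ x e s)
    (hasDerivAt_circ e (-x) s)
  rwa [circ_neg_neg, map_neg, fderiv_radialExt_self hφ h0, neg_zero, add_zero] at h

/-- The quadratic form of `A[φ]` in terms of the derivatives of the radial extension. -/
theorem inner_A_apply_self (hφ : ContMDiff (𝓡 n) 𝓘(ℝ, ℝ) ∞ φ) (x : Sph n) {v : Tan x}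
    (hv : ‖(v : Amb n)‖ = 1) :
    inner ℝ (A φ x v) v = fderiv ℝ (fderiv ℝ (radialExt φ)) (x : Amb n) v v
      + (-(‖grad φ x‖ ^ 2 / (2 * φ x)) + (φ x - 1 / φ x) / 2) := by
  have : ‖v‖ = 1 := hv
  rw [inner_A hφ, real_inner_self_eq_norm_sq, this]
  ring

theorem abs_fderiv_le_norm_grad (x : Sph n) {v : Amb n} (hv : ‖v‖ = 1) :
    fderiv ℝ (radialExt φ) (x : Amb n) v ^ 2 ≤ ‖grad φ x‖ ^ 2 := by
  rw [norm_grad, sq_le_sq, abs_norm, ← Real.norm_eq_abs]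
  simpa [hv] using (fderiv ℝ (radialExt φ) (x : Amb n)).le_opNorm v

/-- Replacing the full gradient by its component along `v` only weakens the inequality, which leaves
a condition on one great circle. -/
theorem hconvex_ode (hφ : ContMDiff (𝓡 n) 𝓘(ℝ, ℝ) ∞ φ) (hpos : ∀ x, 0 < φ x)
    (hconv : ∀ x, ∀ v : Tan x, v ≠ 0 → 0 < inner ℝ (A φ x v) v) {y v : Amb n} (hy : ‖y‖ = 1)
    (hv : ‖v‖ = 1) (hyv : inner ℝ y v = 0) :
    fderiv ℝ (radialExt φ) y v ^ 2 / (2 * radialExt φ y)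
      - (radialExt φ y - 1 / radialExt φ y) / 2 < fderiv ℝ (fderiv ℝ (radialExt φ)) y v v := by
  let x : Sph n := ⟨y, by simpa using hy⟩
  let v' : Tan x := ⟨v, (mem_tan_iff x v).2 hyv⟩
  have hv' : v' ≠ 0 := by
    intro h
    exact ne_zero_of_norm_eq_one hv (congrArg Subtype.val h)
  have h1 := hconv x v' hv'
  rw [inner_A_apply_self hφ x (v := v') hv] at h1
  have h2 := abs_fderiv_le_norm_grad (φ := φ) x hv
  have h3 : radialExt φ y = φ x := radialExt_coe φ x
  have h4 := hpos x
  rw [h3]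
  have h5 : fderiv ℝ (radialExt φ) y v ^ 2 / (2 * φ x) ≤ ‖grad φ x‖ ^ 2 / (2 * φ x) := by
    gcongr
  have h6 : fderiv ℝ (fderiv ℝ (radialExt φ)) (x : Amb n) v' v'
    = fderiv ℝ (fderiv ℝ (radialExt φ)) y v v := rfl
  linarith

end GreatCircles

/-! ### A priori bounds on the solution and its gradient -/

section Estimates

variable {n k : ℕ} {f φ : Sph n → ℝ}

theorem radialExt_of_norm_eq_one (φ : Sph n → ℝ) {y : Amb n} (hy : ‖y‖ = 1) :
    radialExt φ y = φ ⟨y, by simpa using hy⟩ :=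
  radialExt_coe φ ⟨y, by simpa using hy⟩

theorem norm_coe_sph (x : Sph n) : ‖(x : Amb n)‖ = 1 := by simp

theorem norm_coe_orthonormalBasis {x : Sph n} (b : OrthonormalBasis (Fin n) ℝ (Tan x)) (i : Fin n) :
    ‖((b i : Tan x) : Amb n)‖ = 1 := b.orthonormal.1 i

theorem inner_coe_tan (x : Sph n) (v : Tan x) : inner ℝ (x : Amb n) (v : Amb n) = 0 :=
  (mem_tan_iff x v).1 v.2

theorem log_radialExt_contDiffAt (hf : ContMDiff (𝓡 n) 𝓘(ℝ, ℝ) ∞ f) (hpos : ∀ x, 0 < f x)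
    {y : Amb n} (hy : y ≠ 0) : ContDiffAt ℝ ∞ (fun y => Real.log (radialExt f y)) y :=
  (radialExt_contDiffAt hf hy).log (radialExt_pos hpos hy).ne'

theorem exists_log_radialExt_bound (hf : ContMDiff (𝓡 n) 𝓘(ℝ, ℝ) ∞ f) (hpos : ∀ x, 0 < f x) :
    ∃ K : ℝ, 0 < K ∧ ∀ y : Amb n, ‖y‖ = 1 → |Real.log (radialExt f y)| ≤ K ∧
      ‖fderiv ℝ (fun y => Real.log (radialExt f y)) y‖ ≤ K ∧
      ‖fderiv ℝ (fderiv ℝ (fun y => Real.log (radialExt f y))) y‖ ≤ K := by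
  have hS : IsCompact (Metric.sphere (0 : Amb n) 1) := isCompact_sphere _ _
  have hne : ∀ y ∈ Metric.sphere (0 : Amb n) 1, y ≠ 0 := fun y hy =>
    ne_zero_of_norm_eq_one (by simpa using hy)
  have h0 : ∀ y ∈ Metric.sphere (0 : Amb n) 1,
      ContDiffAt ℝ ∞ (fun y => Real.log (radialExt f y)) y :=
    fun y hy => log_radialExt_contDiffAt hf hpos (hne y hy)
  obtain ⟨K0, hK0⟩ := hS.exists_bound_of_continuousOn
    (f := fun y => Real.log (radialExt f y)) fun y hy => (h0 y hy).continuousAt.continuousWithinAt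
  obtain ⟨K1, hK1⟩ := hS.exists_bound_of_continuousOn
    (f := fderiv ℝ (fun y => Real.log (radialExt f y)))
    fun y hy => (contDiffAt_fderiv_of_contDiffAt_top (h0 y hy)).continuousAt.continuousWithinAt
  obtain ⟨K2, hK2⟩ := hS.exists_bound_of_continuousOn
    (f := fderiv ℝ (fderiv ℝ (fun y => Real.log (radialExt f y))))
    fun y hy => (contDiffAt_fderiv_of_contDiffAt_top
      (contDiffAt_fderiv_of_contDiffAt_top (h0 y hy))).continuousAt.continuousWithinAt
  refine ⟨max 1 (max K0 (max K1 K2)), lt_max_of_lt_left one_pos, fun y hy => ?_⟩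
  have hy' : y ∈ Metric.sphere (0 : Amb n) 1 := by simpa using hy
  refine ⟨(hK0 y hy').trans ?_, (hK1 y hy').trans ?_, (hK2 y hy').trans ?_⟩ <;> simp

theorem IsSolution.log_quot_eq (hφ : IsSolution n k f φ) (hf : ∀ x, 0 < f x) (x : Sph n) :
    Real.log (sigma n (A φ x) / sigma (n - k) (A φ x)) = Real.log (f x) - k * Real.log (φ x) := by
  rw [hφ.eqn, Real.log_mul (zpow_ne_zero _ (hφ.pos x).ne') (hf x).ne', Real.log_zpow]
  push_cast
  ring

theorem IsSolution.exists_eigenbasis (hφ : IsSolution n k f φ) (x : Sph n) :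
    ∃ (b : OrthonormalBasis (Fin n) ℝ (Tan x)) (l : Fin n → ℝ), (∀ i, 0 < l i) ∧
      (∀ i, A φ x (b i) = l i • b i) := by
  have hT := A_isSymmetric hφ.smooth x
  refine ⟨hT.eigenvectorBasis (finrank_tan x), hT.eigenvalues (finrank_tan x), fun i => ?_,
    fun i => hT.apply_eigenvectorBasis (finrank_tan x) i⟩
  set b := hT.eigenvectorBasis (finrank_tan x)
  have := hφ.hconvex x (b i) (b.orthonormal.ne_zero i)
  have hb := hT.apply_eigenvectorBasis (finrank_tan x) i
  rw [hb, real_inner_smul_left, real_inner_self_eq_norm_sq, b.orthonormal.1, one_pow,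
    mul_one] at this
  exact this

theorem eigenvalue_eq (hφ : ContMDiff (𝓡 n) 𝓘(ℝ, ℝ) ∞ φ) {x : Sph n} {v : Tan x} {μ : ℝ}
    (hv : ‖(v : Amb n)‖ = 1) (h : A φ x v = μ • v) :
    μ = fderiv ℝ (fderiv ℝ (radialExt φ)) (x : Amb n) v v
      + (-(‖grad φ x‖ ^ 2 / (2 * φ x)) + (φ x - 1 / φ x) / 2) := by
  have hv' : ‖v‖ = 1 := hv
  rw [← inner_A_apply_self hφ x hv, h, real_inner_smul_left, real_inner_self_eq_norm_sq, hv']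
  ring

instance : Nonempty (Sph n) := ⟨⟨EuclideanSpace.single 0 1, by simp⟩⟩

theorem derivatives_at_max (hφ : ContMDiff (𝓡 n) 𝓘(ℝ, ℝ) ∞ φ) {x : Sph n}
    (hx : ∀ y, φ y ≤ φ x) {e : Amb n} (he : ‖e‖ = 1) (hxe : inner ℝ (x : Amb n) e = 0) :
    fderiv ℝ (radialExt φ) (x : Amb n) e = 0 ∧
      fderiv ℝ (fderiv ℝ (radialExt φ)) (x : Amb n) e e ≤ 0 := by
  have h1 := hasDerivAt_radialExt_circ hφ (norm_coe_sph x) he hxe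
  have h2 := hasDerivAt_fderiv_radialExt_circ hφ (norm_coe_sph x) he hxe 0
  have hmax : IsLocalMax (fun s => radialExt φ (circ (x : Amb n) e s)) 0 := by
    refine Filter.Eventually.of_forall fun s => ?_
    simp only [circ_zero, radialExt_coe]
    rw [radialExt_of_norm_eq_one φ (norm_circ (norm_coe_sph x) he hxe s)]
    exact hx _
  have h3 := hmax.hasDerivAt_eq_zero (h1 0)
  have h4 := nonpos_of_isLocalMax_of_hasDerivAt h1 h2 hmax
  rw [circ_zero, circ_zero] at h3 h4
  exact ⟨h3, h4⟩

theorem derivatives_at_min (hφ : ContMDiff (𝓡 n) 𝓘(ℝ, ℝ) ∞ φ) {x : Sph n}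
    (hx : ∀ y, φ x ≤ φ y) {e : Amb n} (he : ‖e‖ = 1) (hxe : inner ℝ (x : Amb n) e = 0) :
    fderiv ℝ (radialExt φ) (x : Amb n) e = 0 ∧
      0 ≤ fderiv ℝ (fderiv ℝ (radialExt φ)) (x : Amb n) e e := by
  have h1 := hasDerivAt_radialExt_circ hφ (norm_coe_sph x) he hxe
  have h2 := hasDerivAt_fderiv_radialExt_circ hφ (norm_coe_sph x) he hxe 0
  have hmin : IsLocalMin (fun s => radialExt φ (circ (x : Amb n) e s)) 0 := by
    refine Filter.Eventually.of_forall fun s => ?_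
    simp only [circ_zero, radialExt_coe]
    rw [radialExt_of_norm_eq_one φ (norm_circ (norm_coe_sph x) he hxe s)]
    exact hx _
  have h3 := hmin.hasDerivAt_eq_zero (h1 0)
  have h4 := nonneg_of_isLocalMin_of_hasDerivAt h1 h2 hmin
  rw [circ_zero, circ_zero] at h3 h4
  exact ⟨h3, h4⟩

theorem IsSolution.half_le_of_inner_nonneg (hφ : IsSolution n k f φ) {x₁ : Sph n}
    (hx₁ : ∀ y, φ y ≤ φ x₁) (x : Sph n) (hx : 0 ≤ inner ℝ (x₁ : Amb n) (x : Amb n)) :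
    φ x₁ / 2 ≤ φ x := by
  set c := inner ℝ (x₁ : Amb n) (x : Amb n) with hc
  have hc1 : c ≤ 1 := by
    have := real_inner_le_norm (x₁ : Amb n) (x : Amb n)
    simpa using this
  rcases hc1.eq_or_lt with h1 | h1
  · have : (x₁ : Amb n) = x := (inner_eq_one_iff_of_norm_eq_one (𝕜 := ℝ) (by simp) (by simp)).1 h1
    rw [← Subtype.ext this]
    linarith [hφ.pos x₁]
  · have hs : 0 < 1 - c ^ 2 := by nlinarith
    have hr : 0 < √(1 - c ^ 2) := Real.sqrt_pos.2 hs
    have hr2 : √(1 - c ^ 2) ^ 2 = 1 - c ^ 2 := Real.sq_sqrt hs.le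
    set r := √(1 - c ^ 2)
    -- Unit direction at `x₁` of the great circle towards `x`, which is reached at angle `arccos c ≤
    -- π/2`.
    let e : Amb n := r⁻¹ • ((x : Amb n) - c • (x₁ : Amb n))
    have hxe : inner ℝ (x₁ : Amb n) e = 0 := by
      simp only [e, real_inner_smul_right, inner_sub_right, real_inner_self_eq_norm_sq,
        norm_coe_sph, ← hc]
      ring
    have he : ‖e‖ = 1 := by
      have h2 : ‖(x : Amb n) - c • (x₁ : Amb n)‖ ^ 2 = r ^ 2 := by
        rw [norm_sub_sq_real, real_inner_smul_right, real_inner_comm, ← hc, norm_smul, mul_pow,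
          Real.norm_eq_abs, sq_abs, norm_coe_sph, norm_coe_sph, hr2]
        ring
      have h3 : ‖(x : Amb n) - c • (x₁ : Amb n)‖ = r := by
        rwa [sq_eq_sq₀ (norm_nonneg _) hr.le] at h2
      rw [norm_smul, h3, norm_inv, Real.norm_of_nonneg hr.le, inv_mul_cancel₀ hr.ne']
    have hcirc : circ (x₁ : Amb n) e (Real.arccos c) = x := by
      rw [circ, Real.cos_arccos (by linarith) hc1, Real.sin_arccos, smul_smul,
        mul_inv_cancel₀ hr.ne', one_smul]
      abel
    have hn := norm_circ (norm_coe_sph x₁) he hxe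
    have h := half_le_of_hconvex_ode
      (hasDerivAt_radialExt_circ hφ.smooth (norm_coe_sph x₁) he hxe)
      (hasDerivAt_fderiv_radialExt_circ hφ.smooth (norm_coe_sph x₁) he hxe)
      (fun t => radialExt_pos hφ.pos (ne_zero_of_norm_eq_one (hn t)))
      (fun t => hconvex_ode hφ.smooth hφ.pos hφ.hconvex (hn t)
        (norm_circ he (by simp) (by rw [inner_neg_right, real_inner_comm, hxe, neg_zero]) t)
        (inner_circ (norm_coe_sph x₁) he hxe t))
      (by rw [circ_zero, circ_zero]; exact (derivatives_at_max hφ.smooth hx₁ he hxe).1)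
      (Real.arccos_nonneg c) (Real.arccos_le_pi_div_two.2 hx)
    rwa [circ_zero, hcirc, radialExt_coe, radialExt_coe] at h

/-- An even uniformly h-convex function varies by a factor of at most `2`. -/
theorem IsSolution.half_le (hφ : IsSolution n k f φ) {x₁ : Sph n}
    (hx₁ : ∀ y, φ y ≤ φ x₁) (x : Sph n) : φ x₁ / 2 ≤ φ x := by
  rcases le_total 0 (inner ℝ (x₁ : Amb n) (x : Amb n)) with h | h
  · exact hφ.half_le_of_inner_nonneg hx₁ x h
  · rw [← hφ.even x]
    refine hφ.half_le_of_inner_nonneg hx₁ (-x) ?_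
    have : ((-x : Sph n) : Amb n) = -(x : Amb n) := rfl
    rw [this, inner_neg_right]
    linarith

/-- At a maximum the Hessian is nonpositive, so `A[φ] > 0` forces `φ > 1`; the factor-two comparison
then gives the lower bound. At a minimum `m` every eigenvalue is at least `(m - 1/m)/2`, and the
equation bounds `m`; the same comparison bounds the maximum. -/
theorem exists_c0_bound (hk : 1 ≤ k) (hkn : k ≤ n) (hf : ContMDiff (𝓡 n) 𝓘(ℝ, ℝ) ∞ f)
    (hpos : ∀ x, 0 < f x) :
    ∃ M : ℝ, 1 ≤ M ∧ ∀ φ, IsSolution n k f φ → ∀ x, 1 / 2 ≤ φ x ∧ φ x ≤ M := by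
  obtain ⟨K, hK0, hK⟩ := exists_log_radialExt_bound hf hpos
  have hk0 : (0 : ℝ) < k := by exact_mod_cast hk
  refine ⟨2 * (1 + 2 * Real.exp ((K + Real.log (n.choose (n - k))) / k)), ?_, fun φ hφ => ?_⟩
  · have := Real.exp_pos ((K + Real.log (n.choose (n - k))) / k)
    linarith
  obtain ⟨x₁, -, hx₁⟩ := isCompact_univ.exists_isMaxOn Set.univ_nonempty
    hφ.smooth.continuous.continuousOn
  replace hx₁ : ∀ y, φ y ≤ φ x₁ := fun y => hx₁ (Set.mem_univ y)
  obtain ⟨x₂, -, hx₂⟩ := isCompact_univ.exists_isMinOn Set.univ_nonempty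
    hφ.smooth.continuous.continuousOn
  replace hx₂ : ∀ y, φ x₂ ≤ φ y := fun y => hx₂ (Set.mem_univ y)
  have hM : 1 < φ x₁ := by
    obtain ⟨b, l, hl, hb⟩ := hφ.exists_eigenbasis x₁
    let i : Fin n := ⟨0, by omega⟩
    have h1 := derivatives_at_max hφ.smooth hx₁ (norm_coe_orthonormalBasis b i)
      (inner_coe_tan x₁ _)
    have h2 := eigenvalue_eq hφ.smooth (norm_coe_orthonormalBasis b i) (hb i)
    have h3 := hl i
    have h4 := hφ.pos x₁
    have h5 : 0 ≤ ‖grad φ x₁‖ ^ 2 / (2 * φ x₁) := by positivity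
    by_contra! h6
    have h7 : 1 ≤ 1 / φ x₁ := by rw [le_div_iff₀ h4]; linarith
    linarith [h1.2]
  have hm : φ x₂ ≤ 1 + 2 * Real.exp ((K + Real.log (n.choose (n - k))) / k) := by
    set m := φ x₂ with hmdef
    have hm0 : 0 < m := hφ.pos x₂
    rcases le_or_gt m 1 with h1 | h1
    · have := Real.exp_pos ((K + Real.log (n.choose (n - k))) / k)
      linarith
    obtain ⟨b, l, hl, hb⟩ := hφ.exists_eigenbasis x₂
    have hgrad : ‖grad φ x₂‖ ^ 2 = 0 := by
      rw [norm_sq_grad hφ.smooth x₂ b]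
      refine Finset.sum_eq_zero fun i _ => ?_
      rw [(derivatives_at_min hφ.smooth hx₂ (norm_coe_orthonormalBasis b i)
        (inner_coe_tan x₂ _)).1]
      simp
    have hg : 0 < (m - 1 / m) / 2 := by
      have : 1 / m < 1 := by rw [div_lt_one hm0]; exact h1
      linarith
    have hgl : ∀ i, (m - 1 / m) / 2 ≤ l i := by
      intro i
      have h2 := (derivatives_at_min hφ.smooth hx₂ (norm_coe_orthonormalBasis b i)
        (inner_coe_tan x₂ _)).2
      have h3 := eigenvalue_eq hφ.smooth (norm_coe_orthonormalBasis b i) (hb i)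
      rw [hgrad, zero_div, neg_zero, zero_add, ← hmdef] at h3
      linarith
    have h4 := log_quot_const_le (Nat.sub_le n k) hg hgl
    rw [← sigma_eq_esym b hb, ← sigma_eq_esym b hb, hφ.log_quot_eq hpos, Nat.sub_sub_self hkn,
      Real.log_div (pow_pos hg k).ne' (by exact_mod_cast (Nat.choose_pos (Nat.sub_le n k)).ne'),
      Real.log_pow, ← hmdef] at h4
    have h5 : Real.log (f x₂) ≤ K := by
      have := (hK x₂ (norm_coe_sph x₂)).1
      rw [radialExt_coe] at this
      exact (le_abs_self _).trans this
    -- The factor `φ^{-k}` supplies an extra `log m`, so `m² - 1` is bounded; `m - 1 ≤ m² - 1` then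
    -- bounds `m`.
    have h6 : Real.log ((m ^ 2 - 1) / 2) = Real.log ((m - 1 / m) / 2) + Real.log m := by
      rw [← Real.log_mul hg.ne' hm0.ne']
      congr 1
      field_simp
    have h7 : Real.log ((m ^ 2 - 1) / 2) ≤ (K + Real.log (n.choose (n - k))) / k := by
      rw [le_div_iff₀ hk0, h6]
      linarith
    rw [Real.log_le_iff_le_exp (by nlinarith)] at h7
    nlinarith
  intro x
  constructor
  · linarith [hφ.half_le hx₁ x]
  · linarith [hφ.half_le hx₁ x₂, hx₁ x]

theorem IsSolution.norm_grad_le (hφ : IsSolution n k f φ) {M : ℝ} (hM : ∀ x, φ x ≤ M) (x : Sph n) :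
    ‖grad φ x‖ ≤ 2 * M := by
  by_cases h0 : grad φ x = 0
  · rw [h0, norm_zero]
    linarith [hφ.pos x, hM x]
  have hn : 0 < ‖grad φ x‖ := norm_pos_iff.2 h0
  let e : Amb n := ‖grad φ x‖⁻¹ • grad φ x
  have he : ‖e‖ = 1 := by simp [e, norm_smul, h0]
  have hxe : inner ℝ (x : Amb n) e = 0 := by
    rw [real_inner_smul_right, (mem_tan_iff x _).1 (grad_mem_tan hφ.smooth x), mul_zero]
  have hc := norm_circ (norm_coe_sph x) he hxe
  have h := deriv_le_of_hconvex_ode (M := M)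
    (hasDerivAt_radialExt_circ hφ.smooth (norm_coe_sph x) he hxe)
    (hasDerivAt_fderiv_radialExt_circ hφ.smooth (norm_coe_sph x) he hxe)
    (fun t => radialExt_pos hφ.pos (ne_zero_of_norm_eq_one (hc t)))
    (fun t => hconvex_ode hφ.smooth hφ.pos hφ.hconvex (hc t)
      (norm_circ he (by simp) (by rw [inner_neg_right, real_inner_comm, hxe, neg_zero]) t)
      (inner_circ (norm_coe_sph x) he hxe t))
    (fun t => by rw [radialExt_of_norm_eq_one φ (hc t)]; exact hM _)
  rw [circ_zero, circ_zero, ← inner_gradient] at h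
  change inner ℝ (grad φ x) e ≤ 2 * M at h
  rw [real_inner_smul_right, real_inner_self_eq_norm_sq] at h
  calc ‖grad φ x‖ = ‖grad φ x‖⁻¹ * ‖grad φ x‖ ^ 2 := by field_simp
    _ ≤ 2 * M := h

end Estimates

/-! ### Rotations in a 2-plane and their infinitesimal generators -/

section Rotations

variable {n : ℕ}

/-- The infinitesimal rotation in the oriented plane spanned by `a` and `b`. -/
def rotGen (a b : Amb n) : Amb n →L[ℝ] Amb n :=
  (innerSL ℝ a).smulRight b - (innerSL ℝ b).smulRight a

/-- The rotation by the angle `t` in the oriented plane spanned by `a` and `b`. -/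
def rot (a b : Amb n) (t : ℝ) : Amb n →L[ℝ] Amb n :=
  ContinuousLinearMap.id ℝ _ + Real.sin t • rotGen a b
    + (1 - Real.cos t) • (rotGen a b).comp (rotGen a b)

theorem rotGen_apply (a b y : Amb n) :
    rotGen a b y = (inner ℝ a y : ℝ) • b - (inner ℝ b y : ℝ) • a := rfl

theorem rot_apply (a b : Amb n) (t : ℝ) (y : Amb n) :
    rot a b t y = y + Real.sin t • rotGen a b y
      + (1 - Real.cos t) • rotGen a b (rotGen a b y) := rfl

theorem rot_zero (a b y : Amb n) : rot a b 0 y = y := by simp [rot_apply]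

theorem inner_rotGen (a b y z : Amb n) :
    inner ℝ (rotGen a b y) z = -inner ℝ y (rotGen a b z) := by
  simp only [rotGen_apply, inner_sub_left, inner_sub_right, real_inner_smul_left,
    real_inner_smul_right, real_inner_comm a y, real_inner_comm b y]
  ring

variable {a b : Amb n}

/-- The square of the generator is minus the projection onto the plane. The relation makes `rot` the
flow of `rotGen`. -/
theorem rotGen_cube (ha : ‖a‖ = 1) (hb : ‖b‖ = 1) (hab : inner ℝ a b = 0)
    (y : Amb n) :
    rotGen a b (rotGen a b (rotGen a b y)) = -rotGen a b y := by
  have h1 : inner ℝ b a = 0 := by rw [real_inner_comm, hab]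
  simp only [rotGen_apply, inner_sub_right, real_inner_smul_right, real_inner_self_eq_norm_sq, ha,
    hb, hab, h1, one_pow, mul_one, mul_zero, sub_zero, zero_sub]
  module

theorem norm_rotGen_le (ha : ‖a‖ = 1) (hb : ‖b‖ = 1) (hab : inner ℝ a b = 0)
    (y : Amb n) : ‖rotGen a b y‖ ≤ ‖y‖ := by
  have h1 : inner ℝ b a = 0 := by rw [real_inner_comm, hab]
  have h2 : ‖rotGen a b y‖ ^ 2 = inner ℝ a y ^ 2 + inner ℝ b y ^ 2 := by
    rw [rotGen_apply, norm_sub_sq_real, norm_smul, norm_smul, real_inner_smul_left,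
      real_inner_smul_right, h1, ha, hb, mul_pow, mul_pow, Real.norm_eq_abs, Real.norm_eq_abs,
      sq_abs, sq_abs]
    ring
  have h3 : 0 ≤ ‖y - ((inner ℝ a y : ℝ) • a + (inner ℝ b y : ℝ) • b)‖ ^ 2 := sq_nonneg _
  rw [norm_sub_sq_real, norm_add_sq_real, norm_smul, norm_smul, inner_add_right,
    real_inner_smul_right, real_inner_smul_right, real_inner_smul_left, real_inner_smul_right,
    hab, ha, hb, mul_pow, mul_pow, Real.norm_eq_abs, Real.norm_eq_abs, sq_abs, sq_abs,
    real_inner_comm a y, real_inner_comm b y] at h3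
  refine le_of_sq_le_sq ?_ (norm_nonneg _)
  nlinarith

theorem hasDerivAt_rot (ha : ‖a‖ = 1) (hb : ‖b‖ = 1) (hab : inner ℝ a b = 0)
    (y : Amb n) (t : ℝ) :
    HasDerivAt (fun t => rot a b t y) (rotGen a b (rot a b t y)) t := by
  have h := (((Real.hasDerivAt_sin t).smul_const (rotGen a b y)).const_add y).add
    (((Real.hasDerivAt_cos t).const_sub 1).smul_const (rotGen a b (rotGen a b y)))
  refine h.congr_deriv ?_
  simp only [rot_apply, map_add, map_sub, map_smul, rotGen_cube ha hb hab, neg_neg, sub_smul, one_smul,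
    smul_neg]
  abel

/-- The derivative in `t` vanishes because the generator is skew. -/
theorem inner_rot_rot (ha : ‖a‖ = 1) (hb : ‖b‖ = 1) (hab : inner ℝ a b = 0)
    (t : ℝ) (y z : Amb n) :
    inner ℝ (rot a b t y) (rot a b t z) = inner ℝ y z := by
  have h : ∀ t, HasDerivAt (fun t => inner ℝ (rot a b t y) (rot a b t z)) 0 t := by
    intro t
    refine ((hasDerivAt_rot ha hb hab y t).inner ℝ (hasDerivAt_rot ha hb hab z t)).congr_deriv ?_
    rw [inner_rotGen]
    ring
  have h2 := is_const_of_deriv_eq_zero (fun t => (h t).differentiableAt) (fun t => (h t).deriv) t 0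
  simpa [rot_zero] using h2

theorem norm_rot (ha : ‖a‖ = 1) (hb : ‖b‖ = 1) (hab : inner ℝ a b = 0)
    (t : ℝ) (y : Amb n) : ‖rot a b t y‖ = ‖y‖ := by
  have h := inner_rot_rot ha hb hab t y y
  rw [real_inner_self_eq_norm_sq, real_inner_self_eq_norm_sq] at h
  exact (sq_eq_sq₀ (norm_nonneg _) (norm_nonneg _)).1 h

theorem rot_circ (t s : ℝ) (x e : Amb n) :
    rot a b t (circ x e s) = circ (rot a b t x) (rot a b t e) s := by
  simp [circ]

/-- The derivative of a function along an infinitesimal rotation. -/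
def rotDeriv (a b : Amb n) (g : Amb n → ℝ) (y : Amb n) : ℝ := fderiv ℝ g y (rotGen a b y)

theorem contDiffAt_rotDeriv {g : Amb n → ℝ} {y : Amb n} (hg : ContDiffAt ℝ ∞ g y) :
    ContDiffAt ℝ ∞ (rotDeriv a b g) y :=
  (contDiffAt_fderiv_of_contDiffAt_top hg).clm_apply (rotGen a b).contDiff.contDiffAt

theorem rotDeriv_rotDeriv {g : Amb n → ℝ} {y : Amb n} (hg : ContDiffAt ℝ ∞ g y) :
    rotDeriv a b (rotDeriv a b g) y =
      fderiv ℝ (fderiv ℝ g) y (rotGen a b y) (rotGen a b y)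
        + fderiv ℝ g y (rotGen a b (rotGen a b y)) := by
  have h1 := ((contDiffAt_fderiv_of_contDiffAt_top hg).differentiableAt (by simp)).hasFDerivAt
  have h2 := h1.clm_apply (rotGen a b).hasFDerivAt (x := y)
  have h3 : fderiv ℝ (rotDeriv a b g) y = _ := h2.fderiv
  rw [rotDeriv, h3]
  simp [add_comm]

theorem hasDerivAt_comp_rot (ha : ‖a‖ = 1) (hb : ‖b‖ = 1) (hab : inner ℝ a b = 0)
    {g : Amb n → ℝ} {y : Amb n} {t : ℝ}
    (hg : ContDiffAt ℝ ∞ g (rot a b t y)) :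
    HasDerivAt (fun t => g (rot a b t y)) (rotDeriv a b g (rot a b t y)) t :=
  hasDerivAt_comp_curve hg (hasDerivAt_rot ha hb hab y t)

/-- Rotating an orthonormal basis of a tangent space. -/
theorem exists_rotated_basis (ha : ‖a‖ = 1) (hb : ‖b‖ = 1) (hab : inner ℝ a b = 0)
    {x : Sph n} (e : OrthonormalBasis (Fin n) ℝ (Tan x)) (t : ℝ)
    {z : Sph n} (hz : (z : Amb n) = rot a b t x) :
    ∃ e' : OrthonormalBasis (Fin n) ℝ (Tan z),
      ∀ i, ((e' i : Tan z) : Amb n) = rot a b t ((e i : Tan x) : Amb n) := by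
  let u : Fin n → Tan z := fun i => ⟨rot a b t ((e i : Tan x) : Amb n), by
    rw [mem_tan_iff, hz, inner_rot_rot ha hb hab, inner_coe_tan]⟩
  have hu : Orthonormal ℝ u := by
    rw [orthonormal_iff_ite]
    intro i j
    have h := (orthonormal_iff_ite.1 e.orthonormal) i j
    rw [← h]
    exact inner_rot_rot ha hb hab t _ _
  have hspan : ⊤ ≤ Submodule.span ℝ (Set.range u) :=
    (hu.linearIndependent.span_eq_top_of_card_eq_finrank' (by simp [finrank_tan])).ge
  refine ⟨OrthonormalBasis.mk hu hspan, fun i => ?_⟩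
  rw [OrthonormalBasis.coe_mk]

end Rotations

/-! ### Symmetry of mixed partial derivatives in the plane -/

section PartialDerivatives

/-- The partial derivative in the first variable. -/
def pd₁ (P : ℝ × ℝ → ℝ) (z : ℝ × ℝ) : ℝ := fderiv ℝ P z (1, 0)

/-- The partial derivative in the second variable. -/
def pd₂ (P : ℝ × ℝ → ℝ) (z : ℝ × ℝ) : ℝ := fderiv ℝ P z (0, 1)

variable {P : ℝ × ℝ → ℝ}

theorem contDiff_pd₁ (hP : ContDiff ℝ ∞ P) : ContDiff ℝ ∞ (pd₁ P) :=
  (hP.fderiv_right (m := ∞) (by simp)).clm_apply contDiff_const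

theorem contDiff_pd₂ (hP : ContDiff ℝ ∞ P) : ContDiff ℝ ∞ (pd₂ P) :=
  (hP.fderiv_right (m := ∞) (by simp)).clm_apply contDiff_const

theorem hasDerivAt_pd₁ (hP : ContDiff ℝ ∞ P) (s t : ℝ) : HasDerivAt (fun s => P (s, t)) (pd₁ P (s, t)) s :=
  (hP.differentiable (by simp) (s, t)).hasFDerivAt.comp_hasDerivAt s
    ((hasDerivAt_id s).prodMk (hasDerivAt_const s t))

theorem hasDerivAt_pd₂ (hP : ContDiff ℝ ∞ P) (s t : ℝ) : HasDerivAt (fun t => P (s, t)) (pd₂ P (s, t)) t :=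
  (hP.differentiable (by simp) (s, t)).hasFDerivAt.comp_hasDerivAt t
    ((hasDerivAt_const t s).prodMk (hasDerivAt_id t))

theorem pd₁_pd₂ (hP : ContDiff ℝ ∞ P) : pd₁ (pd₂ P) = pd₂ (pd₁ P) := by
  ext z
  have hd : DifferentiableAt ℝ (fderiv ℝ P) z :=
    (hP.fderiv_right (m := ∞) (by simp)).differentiable (by simp) z
  have hs : IsSymmSndFDerivAt ℝ P z := hP.contDiffAt.isSymmSndFDerivAt
    (by simp only [minSmoothness_of_isRCLikeNormedField]; exact WithTop.coe_le_coe.2 (le_top (a := (2 : ℕ∞))))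
  have h : ∀ u v : ℝ × ℝ, fderiv ℝ (fun z => fderiv ℝ P z u) z v = fderiv ℝ (fderiv ℝ P) z v u := by
    intro u v
    rw [(hd.hasFDerivAt.clm_apply (hasFDerivAt_const u z)).fderiv]
    simp
  change fderiv ℝ (fun z => fderiv ℝ P z (0, 1)) z (1, 0)
    = fderiv ℝ (fun z => fderiv ℝ P z (1, 0)) z (0, 1)
  rw [h, h, hs.eq]

end PartialDerivatives

/-! ### Commuting rotational and great-circle derivatives -/

section Commutation

variable {n : ℕ} {φ : Sph n → ℝ} {a b : Amb n}

/-- Commuting rotational derivatives with the derivatives in a fixed tangent direction, at a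
maximum of the second rotational derivative. -/
theorem exists_rot_derivatives_at_max (hφ : ContMDiff (𝓡 n) 𝓘(ℝ, ℝ) ∞ φ) (ha : ‖a‖ = 1)
    (hb : ‖b‖ = 1) (hab : inner ℝ a b = 0) {x e : Amb n} (hx : ‖x‖ = 1) (he : ‖e‖ = 1)
    (hxe : inner ℝ x e = 0)
    (hmax : ∀ y : Amb n, ‖y‖ = 1 → rotDeriv a b (rotDeriv a b (radialExt φ)) y
      ≤ rotDeriv a b (rotDeriv a b (radialExt φ)) x) :
    ∃ (β₁ α₁ : ℝ → ℝ) (α₂ : ℝ),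
      (∀ t, HasDerivAt (fun t => fderiv ℝ (radialExt φ) (rot a b t x) (rot a b t e)) (β₁ t) t) ∧
      β₁ 0 = fderiv ℝ (rotDeriv a b (radialExt φ)) x e ∧ HasDerivAt β₁ 0 0 ∧
      (∀ t, HasDerivAt (fun t => fderiv ℝ (fderiv ℝ (radialExt φ)) (rot a b t x) (rot a b t e)
        (rot a b t e)) (α₁ t) t) ∧ HasDerivAt α₁ α₂ 0 ∧ α₂ ≤ 0 := by
  set Φ := radialExt φ with hΦ
  have hn : ∀ s t, ‖rot a b t (circ x e s)‖ = 1 := fun s t => by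
    rw [norm_rot ha hb hab, norm_circ hx he hxe]
  have hsm : ∀ y : Amb n, ‖y‖ = 1 → ContDiffAt ℝ ∞ Φ y := fun y hy =>
    radialExt_contDiffAt hφ (ne_zero_of_norm_eq_one hy)
  have hsv : ∀ y : Amb n, ‖y‖ = 1 → ContDiffAt ℝ ∞ (rotDeriv a b Φ) y := fun y hy =>
    contDiffAt_rotDeriv (hsm y hy)
  have hsw : ∀ y : Amb n, ‖y‖ = 1 → ContDiffAt ℝ ∞ (rotDeriv a b (rotDeriv a b Φ)) y :=
    fun y hy => contDiffAt_rotDeriv (hsv y hy)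
  -- Rotations carry great circles to great circles. At `s = 0` the `s`-derivatives of `P` are thus
  -- the gradient and Hessian entries in the rotated frame, while its `t`-derivatives are rotational
  -- derivatives of `φ`; Schwarz's theorem exchanges the two.
  let P : ℝ × ℝ → ℝ := fun z => Φ (rot a b z.2 (circ x e z.1))
  have hP : ContDiff ℝ ∞ P := by
    rw [contDiff_iff_contDiffAt]
    intro z
    refine (hsm _ (hn z.1 z.2)).comp z (f := fun z : ℝ × ℝ => rot a b z.2 (circ x e z.1)) ?_
    simp only [rot_apply, circ]
    fun_prop
  have h1 := contDiff_pd₁ hP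
  have h2 := contDiff_pd₂ hP
  have h11 := contDiff_pd₁ h1
  have h22 := contDiff_pd₂ h2
  have e2 : ∀ s t, pd₂ P (s, t) = rotDeriv a b Φ (rot a b t (circ x e s)) := fun s t =>
    (hasDerivAt_pd₂ hP s t).unique (hasDerivAt_comp_rot ha hb hab (hsm _ (hn s t)))
  have e22 : ∀ s t, pd₂ (pd₂ P) (s, t)
      = rotDeriv a b (rotDeriv a b Φ) (rot a b t (circ x e s)) := by
    intro s t
    refine (hasDerivAt_pd₂ h2 s t).unique ?_
    simp only [e2]
    exact hasDerivAt_comp_rot ha hb hab (hsv _ (hn s t))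
  have hrx : ∀ t, ‖rot a b t x‖ = 1 := fun t => by rw [norm_rot ha hb hab, hx]
  have hre : ∀ t, ‖rot a b t e‖ = 1 := fun t => by rw [norm_rot ha hb hab, he]
  have hrxe : ∀ t, inner ℝ (rot a b t x) (rot a b t e) = 0 := fun t => by
    rw [inner_rot_rot ha hb hab, hxe]
  have e1 : ∀ s t, pd₁ P (s, t) = fderiv ℝ Φ (circ (rot a b t x) (rot a b t e) s)
      (circ (rot a b t e) (-rot a b t x) s) := by
    intro s t
    refine (hasDerivAt_pd₁ hP s t).unique ?_
    simp only [P, rot_circ]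
    exact hasDerivAt_radialExt_circ hφ (hrx t) (hre t) (hrxe t) s
  have e11 : ∀ t, pd₁ (pd₁ P) (0, t)
      = fderiv ℝ (fderiv ℝ Φ) (rot a b t x) (rot a b t e) (rot a b t e) := by
    intro t
    refine (hasDerivAt_pd₁ h1 0 t).unique ?_
    simp only [e1]
    have := hasDerivAt_fderiv_radialExt_circ hφ (hrx t) (hre t) (hrxe t) 0
    rwa [circ_zero, circ_zero] at this
  have e1' : ∀ t, pd₁ P (0, t) = fderiv ℝ Φ (rot a b t x) (rot a b t e) := by
    intro t
    rw [e1, circ_zero, circ_zero]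
  -- At `t = 0` the second `t`-derivative is the maximised function along a great circle through
  -- `x`.
  have hmaxw : IsLocalMax (fun s => pd₂ (pd₂ P) (s, 0)) 0 := by
    refine Filter.Eventually.of_forall fun s => ?_
    simp only [e22, rot_zero, circ_zero]
    exact hmax _ (norm_circ hx he hxe s)
  have c1 : pd₂ (pd₂ (pd₁ P)) = pd₁ (pd₂ (pd₂ P)) := by
    rw [← pd₁_pd₂ hP, ← pd₁_pd₂ h2]
  have c2 : pd₂ (pd₂ (pd₁ (pd₁ P))) = pd₁ (pd₁ (pd₂ (pd₂ P))) := by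
    rw [← pd₁_pd₂ h1, ← pd₁_pd₂ hP, ← pd₁_pd₂ (contDiff_pd₁ h2), ← pd₁_pd₂ h2]
  refine ⟨fun t => pd₂ (pd₁ P) (0, t), fun t => pd₂ (pd₁ (pd₁ P)) (0, t),
    pd₂ (pd₂ (pd₁ (pd₁ P))) (0, 0), fun t => ?_, ?_, ?_, fun t => ?_, ?_, ?_⟩
  · simp only [← e1']
    exact hasDerivAt_pd₂ h1 0 t
  · rw [← pd₁_pd₂ hP]
    refine (hasDerivAt_pd₁ h2 0 0).unique ?_
    simp only [e2, rot_zero]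
    have h := hasDerivAt_comp_curve (g := rotDeriv a b Φ) (γ := circ x e) (s := 0)
      (hsv _ (norm_circ hx he hxe 0)) (hasDerivAt_circ x e 0)
    rwa [circ_zero, circ_zero] at h
  · have h := hasDerivAt_pd₂ (contDiff_pd₂ h1) 0 0
    rwa [c1, hmaxw.hasDerivAt_eq_zero (hasDerivAt_pd₁ h22 0 0)] at h
  · simp only [← e11]
    exact hasDerivAt_pd₂ h11 0 t
  · exact hasDerivAt_pd₂ (contDiff_pd₂ h11) 0 0
  · rw [c2]
    exact nonpos_of_isLocalMax_of_hasDerivAt (fun s => hasDerivAt_pd₁ h22 s 0)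
      (hasDerivAt_pd₁ (contDiff_pd₁ h22) 0 0) hmaxw

end Commutation

/-! ### The maximum principle and the eigenvalue bound -/

section SecondOrderEstimate

/-- The function differentiated is the coefficient of the identity in `A[φ]`, with `q` for `φ` and
`N` for `|Dφ|²`. -/
theorem hasDerivAt_zeroth_order_term {q q₁ N N₁ : ℝ → ℝ} {t : ℝ} (hq : HasDerivAt q (q₁ t) t)
    (hN : HasDerivAt N (N₁ t) t) (hpos : 0 < q t) :
    HasDerivAt (fun t => -(N t / (2 * q t)) + (q t - 1 / q t) / 2)
      (-(N₁ t / (2 * q t)) + N t * q₁ t / (2 * q t ^ 2) + q₁ t / 2 + q₁ t / (2 * q t ^ 2)) t := by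
  have h1 := (hN.div (hq.const_mul 2) (by positivity)).neg
  have h2 := (hq.sub ((hasDerivAt_const t (1 : ℝ)).div hq hpos.ne')).div_const 2
  refine (h1.add h2).congr_deriv ?_
  field_simp
  ring

theorem hasDerivAt_deriv_zeroth_order_term {q q₁ N N₁ : ℝ → ℝ} {q₂ N₂ t : ℝ}
    (hq : HasDerivAt q (q₁ t) t) (hq₁ : HasDerivAt q₁ q₂ t) (hN : HasDerivAt N (N₁ t) t)
    (hN₁ : HasDerivAt N₁ N₂ t) (hpos : 0 < q t) :
    HasDerivAt (fun t =>
        -(N₁ t / (2 * q t)) + N t * q₁ t / (2 * q t ^ 2) + q₁ t / 2 + q₁ t / (2 * q t ^ 2))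
      (-(N₂ / (2 * q t)) + N₁ t * q₁ t / q t ^ 2 + N t * q₂ / (2 * q t ^ 2)
        - N t * q₁ t ^ 2 / q t ^ 3 + q₂ / 2 + q₂ / (2 * q t ^ 2) - q₁ t ^ 2 / q t ^ 3) t := by
  have h1 := (hN₁.div (hq.const_mul 2) (by positivity)).neg
  have hq2 := (hq.pow 2).const_mul 2
  have h2 := (hN.mul hq₁).div hq2 (by simp; positivity)
  have h3 := hq₁.div hq2 (by simp; positivity)
  refine (((h1.add h2).add (hq₁.div_const 2)).add h3).congr_deriv ?_
  simp only [Pi.pow_apply, Pi.mul_apply]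
  field_simp
  ring

/-- The quadratic gradient term dominates at a maximum of the second derivative. -/
theorem zeroth_order_term_second_deriv_le {n : ℕ} {β β₁ : Fin n → ℝ} {q q₁ w M : ℝ}
    (hq : 1 / 2 ≤ q) (hqM : q ≤ M) (hβ : ∑ j, β j ^ 2 ≤ (2 * M) ^ 2) (hq₁ : q₁ ^ 2 ≤ (2 * M) ^ 2)
    (hw : 0 ≤ w) (hwβ : w ^ 2 ≤ ∑ j, β₁ j ^ 2) :
    -((∑ j, 2 * β₁ j ^ 2) / (2 * q)) + (∑ j, 2 * (β j * β₁ j)) * q₁ / q ^ 2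
        + (∑ j, β j ^ 2) * w / (2 * q ^ 2) - (∑ j, β j ^ 2) * q₁ ^ 2 / q ^ 3 + w / 2
        + w / (2 * q ^ 2) - q₁ ^ 2 / q ^ 3
      ≤ -(w ^ 2 / (2 * M)) + (8 * M ^ 2 + 5 / 2) * w + 128 * M ^ 4 := by
  have hq0 : 0 < q := by linarith
  have hM0 : 0 < M := by linarith
  set N := ∑ j, β j ^ 2 with hN
  set S := ∑ j, β₁ j ^ 2 with hS
  have hN0 : 0 ≤ N := Finset.sum_nonneg fun j _ => sq_nonneg _
  have hi : 1 / q ≤ 2 := by rw [div_le_iff₀ hq0]; linarith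
  have hi0 : 0 ≤ 1 / q := by positivity
  have hi2 : (1 / q) ^ 2 ≤ 4 := by nlinarith
  have hi3 : (1 / q) ^ 3 ≤ 8 := by
    calc (1 / q) ^ 3 ≤ 2 ^ 3 := by gcongr
      _ = 8 := by norm_num
  -- Completing the square spends half of the good term `S / q`; the other half yields `w² / (2M)`.
  -- One of the two copies of `N q₁² / q³` cancels against the negative term in the goal.
  have hcross : (∑ j, 2 * (β j * β₁ j)) * q₁ / q ^ 2 ≤ S / (2 * q) + 2 * (N * q₁ ^ 2 / q ^ 3) := by
    rw [hS, hN, Finset.sum_mul, Finset.sum_div, Finset.sum_div, Finset.sum_mul, Finset.sum_div,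
      Finset.mul_sum, ← Finset.sum_add_distrib]
    refine Finset.sum_le_sum fun j _ => ?_
    have h : β₁ j ^ 2 / (2 * q) + 2 * (β j ^ 2 * q₁ ^ 2 / q ^ 3) - 2 * (β j * β₁ j) * q₁ / q ^ 2
        = (β₁ j - 2 * (β j * q₁ / q)) ^ 2 / (2 * q) := by
      field_simp
      ring
    have h' : 0 ≤ (β₁ j - 2 * (β j * q₁ / q)) ^ 2 / (2 * q) := by positivity
    linarith
  have hfirst : (∑ j, 2 * β₁ j ^ 2) / (2 * q) = S / q := by
    rw [← Finset.mul_sum, ← hS]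
    field_simp
  have hSq : w ^ 2 / (2 * M) ≤ S / (2 * q) := by gcongr
  have hSq' : S / q = S / (2 * q) + S / (2 * q) := by field_simp; ring
  have hNq : N * q₁ ^ 2 / q ^ 3 ≤ 128 * M ^ 4 := by
    calc N * q₁ ^ 2 / q ^ 3 = N * q₁ ^ 2 * (1 / q) ^ 3 := by field_simp
      _ ≤ (2 * M) ^ 2 * (2 * M) ^ 2 * 8 := by gcongr
      _ = 128 * M ^ 4 := by ring
  have hNw : N * w / (2 * q ^ 2) ≤ 8 * M ^ 2 * w := by
    calc N * w / (2 * q ^ 2) = N * w * (1 / q) ^ 2 / 2 := by field_simp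
      _ ≤ (2 * M) ^ 2 * w * 4 / 2 := by gcongr
      _ = 8 * M ^ 2 * w := by ring
  have hww : w / (2 * q ^ 2) ≤ 2 * w := by
    calc w / (2 * q ^ 2) = w * (1 / q) ^ 2 / 2 := by field_simp
      _ ≤ w * 4 / 2 := by gcongr
      _ = 2 * w := by ring
  have hlast : 0 ≤ q₁ ^ 2 / q ^ 3 := by positivity
  rw [hfirst]
  linarith

/-- For larger `w` the bracket is below `-(2κ + 2K) w / p₀`. Being negative, it only gets worse when
multiplied by `p ≥ p₀`, so no upper bound on `p` is needed; `w > 1` gives the contradiction. -/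
theorem le_max_of_quadratic_inequality {w p p₀ M H G K κ : ℝ} (hM : 0 < M) (hp₀ : 0 < p₀)
    (hp : p₀ ≤ p) (hG : 0 ≤ G) (hK : 0 ≤ K)
    (h : -(2 * κ * w) - 2 * K ≤ p * (-(w ^ 2 / (2 * M)) + H * w + G)) (hκ : 0 ≤ κ) :
    w ≤ max 1 (2 * M * (H + G + (2 * κ + 2 * K) / p₀)) := by
  by_contra! hw
  have h1 : 1 < w := (le_max_left _ _).trans_lt hw
  have h2 : 2 * M * (H + G + (2 * κ + 2 * K) / p₀) < w := (le_max_right _ _).trans_lt hw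
  have h3 : H + G + (2 * κ + 2 * K) / p₀ < w / (2 * M) := by
    rw [lt_div_iff₀ (by positivity)]
    linarith
  have h4 : (H + G + (2 * κ + 2 * K) / p₀) * w < w ^ 2 / (2 * M) := by
    have := mul_lt_mul_of_pos_right h3 (by linarith : 0 < w)
    calc _ < _ := this
      _ = _ := by ring
  set r := (2 * κ + 2 * K) / p₀ with hr
  have hr0 : 0 ≤ r := by positivity
  have h5 : -(w ^ 2 / (2 * M)) + H * w + G < -(r * w) := by nlinarith
  have h6 : p * (-(w ^ 2 / (2 * M)) + H * w + G) < p * -(r * w) :=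
    mul_lt_mul_of_pos_left h5 (by linarith)
  have h7 : p * -(r * w) ≤ p₀ * -(r * w) := by
    have : 0 ≤ r * w := by positivity
    nlinarith
  have h8 : p₀ * r = 2 * κ + 2 * K := by rw [hr]; field_simp
  have h9 : p₀ * -(r * w) = -((2 * κ + 2 * K) * w) := by rw [← h8]; ring
  nlinarith

variable {n k : ℕ} {f φ : Sph n → ℝ} {a b : Amb n}

theorem abs_rotDeriv_rotDeriv_le {g : Amb n → ℝ} {y : Amb n} {K : ℝ} (hg : ContDiffAt ℝ ∞ g y)
    (hy : ‖y‖ = 1) (h1 : ‖fderiv ℝ g y‖ ≤ K) (h2 : ‖fderiv ℝ (fderiv ℝ g) y‖ ≤ K)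
    (ha : ‖a‖ = 1) (hb : ‖b‖ = 1) (hab : inner ℝ a b = 0) :
    |rotDeriv a b (rotDeriv a b g) y| ≤ 2 * K := by
  have hJ : ‖rotGen a b y‖ ≤ 1 := (norm_rotGen_le ha hb hab y).trans hy.le
  have hJ2 : ‖rotGen a b (rotGen a b y)‖ ≤ 1 := (norm_rotGen_le ha hb hab _).trans hJ
  have hK : 0 ≤ K := (norm_nonneg _).trans h1
  rw [rotDeriv_rotDeriv hg]
  have e1 : |fderiv ℝ (fderiv ℝ g) y (rotGen a b y) (rotGen a b y)| ≤ K := by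
    calc _ ≤ ‖fderiv ℝ (fderiv ℝ g) y‖ * ‖rotGen a b y‖ * ‖rotGen a b y‖ :=
          (fderiv ℝ (fderiv ℝ g) y).le_opNorm₂ _ _
      _ ≤ K * 1 * 1 := by gcongr
      _ = K := by ring
  have e2 : |fderiv ℝ g y (rotGen a b (rotGen a b y))| ≤ K := by
    calc _ ≤ ‖fderiv ℝ g y‖ * ‖rotGen a b (rotGen a b y)‖ := (fderiv ℝ g y).le_opNorm _
      _ ≤ K * 1 := by gcongr
      _ = K := by ring
  linarith [abs_add_le (fderiv ℝ (fderiv ℝ g) y (rotGen a b y) (rotGen a b y))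
    (fderiv ℝ g y (rotGen a b (rotGen a b y)))]

theorem rotGen_mem_tan (a b : Amb n) (x : Sph n) : rotGen a b (x : Amb n) ∈ Tan x := by
  rw [mem_tan_iff]
  have h := inner_rotGen a b (x : Amb n) x
  rw [real_inner_comm] at h
  linarith

/-- The derivative of a function in the direction of the rotation is controlled by its tangential
derivatives. -/
theorem sq_rotDeriv_le_sum {x : Sph n} (e : OrthonormalBasis (Fin n) ℝ (Tan x)) (g : Amb n → ℝ)
    (ha : ‖a‖ = 1) (hb : ‖b‖ = 1) (hab : inner ℝ a b = 0) :
    rotDeriv a b g x ^ 2 ≤ ∑ j, fderiv ℝ g (x : Amb n) (e j) ^ 2 := by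
  let u : Tan x := ⟨rotGen a b x, rotGen_mem_tan a b x⟩
  have hu : ‖u‖ ^ 2 ≤ 1 := by
    have : ‖u‖ ≤ 1 := (norm_rotGen_le ha hb hab (x : Amb n)).trans (norm_coe_sph x).le
    nlinarith [norm_nonneg u]
  have h1 : ∑ j, inner ℝ (e j) u ^ 2 = ‖u‖ ^ 2 := by
    simpa using e.sum_sq_norm_inner_right u
  have h2 : rotDeriv a b g x = ∑ j, inner ℝ (e j) u * fderiv ℝ g (x : Amb n) (e j) := by
    have h3 : rotGen a b (x : Amb n) = ∑ j, (inner ℝ (e j) u : ℝ) • ((e j : Tan x) : Amb n) := by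
      have := congrArg (Subtype.val) (e.sum_repr' u)
      rw [← Submodule.coe_subtype, map_sum] at this
      simpa using this.symm
    rw [rotDeriv, h3, map_sum]
    simp
  rw [h2]
  calc _ ≤ (∑ j, inner ℝ (e j) u ^ 2) * ∑ j, fderiv ℝ g (x : Amb n) (e j) ^ 2 :=
        Finset.sum_mul_sq_le_sq_mul_sq _ _ _
    _ ≤ 1 * ∑ j, fderiv ℝ g (x : Amb n) (e j) ^ 2 := by
        rw [h1]
        exact mul_le_mul_of_nonneg_right hu (Finset.sum_nonneg fun j _ => sq_nonneg _)
    _ = _ := one_mul _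

/-- The maximum principle applied to the second derivative of a solution along a rotation. -/
theorem IsSolution.rot_inequality (hφ : IsSolution n k f φ)
    (hf : ContMDiff (𝓡 n) 𝓘(ℝ, ℝ) ∞ f) (hpos : ∀ x, 0 < f x) (ha : ‖a‖ = 1) (hb : ‖b‖ = 1)
    (hab : inner ℝ a b = 0) {x : Sph n}
    (hmax : ∀ y : Amb n, ‖y‖ = 1 → rotDeriv a b (rotDeriv a b (radialExt φ)) y
      ≤ rotDeriv a b (rotDeriv a b (radialExt φ)) x) :
    ∃ (l β β₁ : Fin n → ℝ), (∀ i, 0 < l i) ∧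
      Real.log (esym n l / esym (n - k) l) = Real.log (f x) - k * Real.log (φ x) ∧
      ∑ j, β j ^ 2 = ‖grad φ x‖ ^ 2 ∧
      (rotDeriv a b (rotDeriv a b (radialExt φ)) x) ^ 2 ≤ ∑ j, β₁ j ^ 2 ∧
      rotDeriv a b (rotDeriv a b (fun y => Real.log (radialExt f y))) x
        - k * (rotDeriv a b (rotDeriv a b (radialExt φ)) x / φ x
          - rotDeriv a b (radialExt φ) x ^ 2 / φ x ^ 2)
      ≤ (∑ i, dlogQuot (n - k) l i) *
        (-((∑ j, 2 * β₁ j ^ 2) / (2 * φ x))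
          + (∑ j, 2 * (β j * β₁ j)) * rotDeriv a b (radialExt φ) x / φ x ^ 2
          + (∑ j, β j ^ 2) * rotDeriv a b (rotDeriv a b (radialExt φ)) x / (2 * φ x ^ 2)
          - (∑ j, β j ^ 2) * rotDeriv a b (radialExt φ) x ^ 2 / φ x ^ 3
          + rotDeriv a b (rotDeriv a b (radialExt φ)) x / 2
          + rotDeriv a b (rotDeriv a b (radialExt φ)) x / (2 * φ x ^ 2)
          - rotDeriv a b (radialExt φ) x ^ 2 / φ x ^ 3) := by
  obtain ⟨e, l, hl, hel⟩ := hφ.exists_eigenbasis x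
  set Φ := radialExt φ with hΦdef
  set L : Amb n → ℝ := fun y => Real.log (radialExt f y) with hLdef
  have hx := norm_coe_sph x
  have hr1 : ∀ t, ‖rot a b t (x : Amb n)‖ = 1 := fun t => by rw [norm_rot ha hb hab, hx]
  have hsΦ : ∀ y : Amb n, ‖y‖ = 1 → ContDiffAt ℝ ∞ Φ y := fun y hy =>
    radialExt_contDiffAt hφ.smooth (ne_zero_of_norm_eq_one hy)
  have hsL : ∀ y : Amb n, ‖y‖ = 1 → ContDiffAt ℝ ∞ L y := fun y hy =>
    log_radialExt_contDiffAt hf hpos (ne_zero_of_norm_eq_one hy)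
  choose β₁ α₁ α₂ hβ hβ0 hβ₁ hα hα₁ hα₂ using fun j =>
    exists_rot_derivatives_at_max hφ.smooth ha hb hab hx (norm_coe_orthonormalBasis e j)
      (inner_coe_tan x (e j)) hmax
  let β : Fin n → ℝ → ℝ := fun j t => fderiv ℝ Φ (rot a b t (x : Amb n)) (rot a b t (e j : Amb n))
  let α : Fin n → ℝ → ℝ := fun j t =>
    fderiv ℝ (fderiv ℝ Φ) (rot a b t (x : Amb n)) (rot a b t (e j : Amb n)) (rot a b t (e j : Amb n))
  let q : ℝ → ℝ := fun t => Φ (rot a b t (x : Amb n))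
  let q₁ : ℝ → ℝ := fun t => rotDeriv a b Φ (rot a b t (x : Amb n))
  let q₂ : ℝ := rotDeriv a b (rotDeriv a b Φ) (x : Amb n)
  let N : ℝ → ℝ := fun t => ∑ j, β j t ^ 2
  let N₁ : ℝ → ℝ := fun t => ∑ j, 2 * (β j t * β₁ j t)
  -- No term in `β` times a second derivative appears, because `β₁` has derivative zero at the
  -- maximum.
  let N₂ : ℝ := ∑ j, 2 * β₁ j 0 ^ 2
  have hq : ∀ t, HasDerivAt q (q₁ t) t := fun t => hasDerivAt_comp_rot ha hb hab (hsΦ _ (hr1 t))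
  have hq₁ : HasDerivAt q₁ q₂ 0 := by
    have h := hasDerivAt_comp_rot (g := rotDeriv a b Φ) (t := 0) (y := (x : Amb n)) ha hb hab
      (contDiffAt_rotDeriv (hsΦ _ (hr1 0)))
    rwa [rot_zero] at h
  have hqpos : ∀ t, 0 < q t := fun t =>
    radialExt_pos hφ.pos (ne_zero_of_norm_eq_one (hr1 t))
  have hN : ∀ t, HasDerivAt N (N₁ t) t := fun t => by
    refine HasDerivAt.fun_sum fun j _ => ((hβ j t).pow 2).congr_deriv ?_
    simp only [β]
    ring
  have hN₁ : HasDerivAt N₁ N₂ 0 := by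
    refine HasDerivAt.fun_sum fun j _ => (((hβ j 0).mul (hβ₁ j)).const_mul 2).congr_deriv ?_
    ring
  let Z : ℝ → ℝ := fun t => -(N t / (2 * q t)) + (q t - 1 / q t) / 2
  let Z₁ : ℝ → ℝ := fun t =>
    -(N₁ t / (2 * q t)) + N t * q₁ t / (2 * q t ^ 2) + q₁ t / 2 + q₁ t / (2 * q t ^ 2)
  have hZ : ∀ t, HasDerivAt Z (Z₁ t) t := fun t =>
    hasDerivAt_zeroth_order_term (hq t) (hN t) (hqpos t)
  have hZ₁ := hasDerivAt_deriv_zeroth_order_term (hq 0) hq₁ (hN 0) hN₁ (hqpos 0)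
  have hL : ∀ t, HasDerivAt (fun t => L (rot a b t (x : Amb n)))
      (rotDeriv a b L (rot a b t (x : Amb n))) t :=
    fun t => hasDerivAt_comp_rot ha hb hab (hsL _ (hr1 t))
  have hL₁ : HasDerivAt (fun t => rotDeriv a b L (rot a b t (x : Amb n)))
      (rotDeriv a b (rotDeriv a b L) (x : Amb n)) 0 := by
    have h := hasDerivAt_comp_rot (g := rotDeriv a b L) (t := 0) (y := (x : Amb n)) ha hb hab
      (contDiffAt_rotDeriv (hsL _ (hr1 0)))
    rwa [rot_zero] at h
  let p : Fin n → ℝ := dlogQuot (n - k) l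
  have hp : ∀ i, 0 ≤ p i := dlogQuot_nonneg (Nat.sub_le n k) hl
  -- the tangent plane inequality along the rotation
  have hpoint : ∀ t, ∃ z : Sph n, (z : Amb n) = rot a b t x := fun t =>
    ⟨⟨rot a b t x, by simpa using hr1 t⟩, rfl⟩
  have hquad : ∀ t (z : Sph n), (z : Amb n) = rot a b t x →
      ∃ e' : OrthonormalBasis (Fin n) ℝ (Tan z), ∀ i,
        inner ℝ (A φ z (e' i)) (e' i) = α i t + Z t := by
    intro t z hz
    obtain ⟨e', he'⟩ := exists_rotated_basis ha hb hab e t hz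
    refine ⟨e', fun i => ?_⟩
    rw [inner_A_apply_self hφ.smooth z (norm_coe_orthonormalBasis e' i),
      norm_sq_grad hφ.smooth z e', ← radialExt_coe φ z]
    simp only [he', hz, α, Z, N, β, q, hΦdef]
  have hl0 : ∀ i, l i = α i 0 + Z 0 := by
    intro i
    have h := eigenvalue_eq hφ.smooth (norm_coe_orthonormalBasis e i) (hel i)
    rw [h, norm_sq_grad hφ.smooth x e, ← radialExt_coe φ x]
    simp only [α, Z, N, β, q, rot_zero, hΦdef]
  have hlog : Real.log (esym n l / esym (n - k) l) = Real.log (f x) - k * Real.log (φ x) := by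
    rw [← sigma_eq_esym e hel, ← sigma_eq_esym e hel, hφ.log_quot_eq hpos]
  -- The gap in the tangent plane inequality along the orbit, with the equation inserted. Its
  -- minimum at `t = 0` yields the differentiated equation as an inequality.
  let h : ℝ → ℝ := fun t => Real.log (esym n l / esym (n - k) l)
    + ∑ i, p i * (α i t + Z t - l i) - (L (rot a b t (x : Amb n)) - k * Real.log (q t))
  have hnonneg : ∀ t, 0 ≤ h t := by
    intro t
    obtain ⟨z, hz⟩ := hpoint t
    obtain ⟨e', he'⟩ := hquad t z hz
    have h1 := log_sigma_quot_le (finrank_tan z) (A_isSymmetric hφ.smooth z) (hφ.hconvex z) e'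
      (Nat.sub_le n k) hl
    rw [hφ.log_quot_eq hpos, ← radialExt_coe f z, ← radialExt_coe φ z, hz] at h1
    simp only [he'] at h1
    simp only [h, p, q, L, hΦdef]
    linarith
  have hzero : h 0 = 0 := by
    simp only [h, ← hl0, sub_self, mul_zero, Finset.sum_const_zero, add_zero, hlog, rot_zero, q, L,
      hΦdef, radialExt_coe]
  have hmin : IsLocalMin h 0 := Filter.Eventually.of_forall fun t => by
    rw [hzero]; exact hnonneg t
  let h₁ : ℝ → ℝ := fun t => ∑ i, p i * (α₁ i t + Z₁ t)
    - (rotDeriv a b L (rot a b t (x : Amb n)) - k * (q₁ t / q t))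
  have hh : ∀ t, HasDerivAt h (h₁ t) t := by
    intro t
    refine HasDerivAt.sub (HasDerivAt.const_add _ ?_)
      ((hL t).sub (((hq t).log (hqpos t).ne').const_mul (k : ℝ)))
    exact HasDerivAt.fun_sum fun i _ => (((hα i t).add (hZ t)).sub_const (l i)).const_mul (p i)
  have hh₁ := HasDerivAt.sub
    (HasDerivAt.fun_sum (u := Finset.univ) fun i _ => ((hα₁ i).add hZ₁).const_mul (p i))
    (hL₁.sub ((hq₁.div (hq 0) (hqpos 0).ne').const_mul (k : ℝ)))
  have hfinal := nonneg_of_isLocalMin_of_hasDerivAt hh hh₁ hmin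
  have hq0 : q 0 = φ x := by simp only [q, rot_zero, hΦdef, radialExt_coe]
  have hq10 : q₁ 0 = rotDeriv a b Φ x := by simp only [q₁, rot_zero]
  refine ⟨l, fun j => β j 0, fun j => β₁ j 0, hl, hlog, ?_, ?_, ?_⟩
  · rw [norm_sq_grad hφ.smooth x e]
    simp only [β, rot_zero, hΦdef]
  -- The `β₁ j 0` are the tangential derivatives of the first rotational derivative, and `w` is its
  -- derivative along the rotation field, of norm at most one.
  · simp only [hβ0]
    exact sq_rotDeriv_le_sum e _ ha hb hab
  · simp only [hq0, hq10] at hfinal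
    simp only [mul_add, Finset.sum_add_distrib (f := fun i => p i * α₂ i), ← Finset.sum_mul]
      at hfinal
    -- Ellipticity: the `p i` are nonnegative and the `α₂ i` are Hessian entries of `w` at its
    -- maximum.
    have hα₂' : ∑ i, p i * α₂ i ≤ 0 :=
      Finset.sum_nonpos fun i _ => mul_nonpos_of_nonneg_of_nonpos (hp i) (hα₂ i)
    have hφx := hφ.pos x
    have e1 : (q₂ * φ x - rotDeriv a b Φ x * rotDeriv a b Φ x) / φ x ^ 2
        = q₂ / φ x - rotDeriv a b Φ x ^ 2 / φ x ^ 2 := by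
      field_simp
    rw [e1] at hfinal
    linarith

theorem exists_rot_bound (hk : 1 ≤ k) (hkn : k ≤ n) (hf : ContMDiff (𝓡 n) 𝓘(ℝ, ℝ) ∞ f)
    (hpos : ∀ x, 0 < f x) {M : ℝ} (hM : 1 ≤ M)
    (hc0 : ∀ φ, IsSolution n k f φ → ∀ x, 1 / 2 ≤ φ x ∧ φ x ≤ M) :
    ∃ C : ℝ, ∀ φ, IsSolution n k f φ → ∀ a b : Amb n, ‖a‖ = 1 → ‖b‖ = 1 → inner ℝ a b = 0 →
      ∀ y : Amb n, ‖y‖ = 1 → rotDeriv a b (rotDeriv a b (radialExt φ)) y ≤ C := by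
  obtain ⟨K, hK0, hK⟩ := exists_log_radialExt_bound hf hpos
  have hk0 : (0 : ℝ) < k := by exact_mod_cast hk
  have hC0 : (0 : ℝ) < n.choose (n - k) := by exact_mod_cast Nat.choose_pos (Nat.sub_le n k)
  -- Chosen so that `s^k / n.choose (n - k) = exp (K + k log 2)`, an upper bound for `φ^{-k} f` when
  -- `φ ≥ 1/2`. The trace of the linearisation is then at least `k / s`.
  set s := Real.exp ((K + k * Real.log 2 + Real.log (n.choose (n - k))) / k) with hs
  have hs0 : 0 < s := Real.exp_pos _
  refine ⟨max 1 (2 * M * ((8 * M ^ 2 + 5 / 2) + 128 * M ^ 4 + (2 * k + 2 * K) / (k / s))),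
    fun φ hφ a b ha hb hab y hy => ?_⟩
  have hcont : ContinuousOn (rotDeriv a b (rotDeriv a b (radialExt φ)))
      (Metric.sphere (0 : Amb n) 1) := fun z hz =>
    (contDiffAt_rotDeriv (contDiffAt_rotDeriv (radialExt_contDiffAt hφ.smooth
      (ne_zero_of_norm_eq_one (by simpa using hz))))).continuousAt.continuousWithinAt
  obtain ⟨x', hx', hmax⟩ := (isCompact_sphere (0 : Amb n) 1).exists_isMaxOn
    ⟨y, by simpa using hy⟩ hcont
  let x : Sph n := ⟨x', hx'⟩
  have hmax' : ∀ z : Amb n, ‖z‖ = 1 → rotDeriv a b (rotDeriv a b (radialExt φ)) z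
      ≤ rotDeriv a b (rotDeriv a b (radialExt φ)) x := fun z hz => hmax (by simpa using hz)
  refine (hmax' y hy).trans ?_
  set w := rotDeriv a b (rotDeriv a b (radialExt φ)) (x : Amb n) with hw
  rcases le_or_gt w 0 with hw0 | hw0
  · exact hw0.trans (le_max_of_le_left zero_le_one)
  obtain ⟨l, β, β₁, hl, hlog, hβ, hβ₁, hineq⟩ :=
    hφ.rot_inequality hf hpos ha hb hab hmax'
  have hx := norm_coe_sph x
  obtain ⟨hφ1, hφ2⟩ := hc0 φ hφ x
  have hgrad := hφ.norm_grad_le (fun z => (hc0 φ hφ z).2) x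
  have hgrad2 : ‖grad φ x‖ ^ 2 ≤ (2 * M) ^ 2 := by gcongr
  have hq₁ : rotDeriv a b (radialExt φ) (x : Amb n) ^ 2 ≤ (2 * M) ^ 2 := by
    have h1 : |rotDeriv a b (radialExt φ) (x : Amb n)| ≤ 2 * M := by
      calc _ ≤ ‖fderiv ℝ (radialExt φ) (x : Amb n)‖ * ‖rotGen a b (x : Amb n)‖ :=
            (fderiv ℝ (radialExt φ) (x : Amb n)).le_opNorm _
        _ ≤ (2 * M) * 1 := by
            rw [← norm_grad]
            gcongr
            exact (norm_rotGen_le ha hb hab _).trans hx.le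
        _ = 2 * M := mul_one _
    rw [← sq_abs]
    gcongr
  have hZ := zeroth_order_term_second_deriv_le hφ1 hφ2 (hβ.le.trans hgrad2) hq₁ hw0.le hβ₁
  obtain ⟨hK1, hK2, hK3⟩ := hK x hx
  have hLw := (abs_le.1 (abs_rotDeriv_rotDeriv_le (log_radialExt_contDiffAt hf hpos
    (ne_zero_of_norm_eq_one hx)) hx hK2 hK3 ha hb hab)).1
  have hp : (k : ℝ) / s ≤ ∑ i, dlogQuot (n - k) l i := by
    have h := le_sum_dlogQuot (Nat.sub_le n k) hl hs0
    rw [Nat.sub_sub_self hkn] at h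
    refine h ?_
    rw [hlog, Real.log_div (pow_pos hs0 k).ne' hC0.ne', Real.log_pow, hs, Real.log_exp]
    have h1 : Real.log (f x) ≤ K := by
      rw [radialExt_coe] at hK1
      exact (le_abs_self _).trans hK1
    have h2 : -Real.log 2 ≤ Real.log (φ x) := by
      rw [← Real.log_inv]
      exact Real.log_le_log (by norm_num) (by linarith)
    have h3 : (k : ℝ) * ((K + k * Real.log 2 + Real.log (n.choose (n - k))) / k)
        = K + k * Real.log 2 + Real.log (n.choose (n - k)) := by field_simp
    rw [h3]
    nlinarith
  have hp0 : 0 < (k : ℝ) / s := div_pos hk0 hs0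
  refine le_max_of_quadratic_inequality (κ := k) (K := K) (by linarith) hp0 hp
    (by positivity) hK0.le ?_ hk0.le
  refine le_trans ?_ (hineq.trans (mul_le_mul_of_nonneg_left hZ (hp0.le.trans hp)))
  have hφ0 := hφ.pos x
  have h1 : w / φ x ≤ 2 * w := by
    rw [div_le_iff₀ hφ0]
    nlinarith
  have h2 : 0 ≤ rotDeriv a b (radialExt φ) (x : Amb n) ^ 2 / φ x ^ 2 := by positivity
  have h3 : (k : ℝ) * (w / φ x - rotDeriv a b (radialExt φ) (x : Amb n) ^ 2 / φ x ^ 2)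
      ≤ k * (2 * w) := mul_le_mul_of_nonneg_left (by linarith) hk0.le
  linarith

/-- The second order estimate for solutions of the Hessian quotient equation. -/
theorem exists_eigenvalue_bound (hk : 1 ≤ k) (hkn : k ≤ n)
    (hf : ContMDiff (𝓡 n) 𝓘(ℝ, ℝ) ∞ f) (hpos : ∀ x, 0 < f x) :
    ∃ C : ℝ, 0 < C ∧ ∀ φ, IsSolution n k f φ → ∀ x, ∀ μ : ℝ,
      Module.End.HasEigenvalue (A φ x) μ → μ ≤ C := by
  obtain ⟨M, hM, hc0⟩ := exists_c0_bound hk hkn hf hpos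
  obtain ⟨C, hC⟩ := exists_rot_bound hk hkn hf hpos hM hc0
  refine ⟨max 1 (C + M), lt_max_of_lt_left one_pos, fun φ hφ x μ hμ => ?_⟩
  obtain ⟨v, hv⟩ := hμ.exists_hasEigenvector
  have hv0 : ‖v‖ ≠ 0 := norm_ne_zero_iff.2 hv.2
  let e : Tan x := ‖v‖⁻¹ • v
  have he : ‖(e : Amb n)‖ = 1 := by
    have : ‖e‖ = 1 := by
      simp only [e]
      rw [norm_smul, norm_inv, norm_norm, inv_mul_cancel₀ hv0]
    exact this
  have hAe : A φ x e = μ • e := by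
    simp only [e, map_smul]
    rw [hv.apply_eq_smul, smul_comm]
  have hxe := inner_coe_tan x e
  have hx := norm_coe_sph x
  -- The rotation in the plane of `x` and `e` moves `x` along the great circle with velocity `e` and
  -- radial acceleration `-x`, so its second rotational derivative at `x` is the Hessian entry at
  -- `e`.
  have hJ : rotGen (x : Amb n) e x = e := by
    rw [rotGen_apply, real_inner_self_eq_norm_sq, hx, real_inner_comm, hxe]
    simp
  have hJe : rotGen (x : Amb n) e e = -(x : Amb n) := by
    rw [rotGen_apply, real_inner_self_eq_norm_sq, he, hxe]
    simp
  have h0 := coe_ne_zero x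
  have h1 := hC φ hφ x e hx he hxe x hx
  rw [rotDeriv_rotDeriv (radialExt_contDiffAt hφ.smooth h0), hJ, hJe, map_neg,
    fderiv_radialExt_self hφ.smooth h0, neg_zero, add_zero] at h1
  have h2 := eigenvalue_eq hφ.smooth he hAe
  have h3 := hφ.pos x
  have h4 : 0 ≤ ‖grad φ x‖ ^ 2 / (2 * φ x) := by positivity
  have h5 : 0 ≤ 1 / φ x := by positivity
  have h6 := (hc0 φ hφ x).2
  refine le_max_of_le_right ?_
  linarith

end SecondOrderEstimate

end HessianQuotient

end

theorem lemma3p3 (n k : ℕ) (hk : 1 ≤ k) (hkn : k ≤ n)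
    (f : HessianQuotient.Sph n → ℝ)
    (hf_smooth : ContMDiff (𝓡 n) 𝓘(ℝ, ℝ) ∞ f)
    (hf_pos : ∀ x, 0 < f x)
    (hf_even : ∀ x, f (-x) = f x) :
    (∀ C₀ C₁ : ℝ, 0 < C₀ → 0 < C₁ → ∃ C : ℝ, 0 < C ∧
      ∀ φ : HessianQuotient.Sph n → ℝ, HessianQuotient.IsSolution n k f φ →
        (∀ x, 1 / C₀ ≤ Real.log (φ x) ∧ Real.log (φ x) ≤ C₀) →
        (∀ x, ‖HessianQuotient.grad φ x‖ ≤ C₁) →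
        ∀ x, ∀ μ : ℝ, Module.End.HasEigenvalue (HessianQuotient.A φ x) μ → μ ≤ C) ∧
    (∃ C : ℝ, 0 < C ∧
      ∀ φ : HessianQuotient.Sph n → ℝ, HessianQuotient.IsSolution n k f φ →
        ∀ x, ∀ μ : ℝ, Module.End.HasEigenvalue (HessianQuotient.A φ x) μ → μ ≤ C) := by
  -- The constant of (ii) also serves in (i), for every `C₀` and `C₁`.
  obtain ⟨C, hC, h⟩ := HessianQuotient.exists_eigenvalue_bound hk hkn hf_smooth hf_pos
  exact ⟨fun _ _ _ _ => ⟨C, hC, fun φ hφ _ _ => h φ hφ⟩, C, hC, h⟩
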